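/- **Theorem (convergence of complex systematic scan Glauber dynamics for the hypergraph independence polynomial).** Let $k\ge 2$, $\Delta\ge 3$, $0<\varepsilon<\frac{1}{9k^5\Delta^2}$, and let $\lambda_{c,\varepsilon}$ be a real number such that for all $\lambda\in[0,\lambda_{c,\varepsilon})$ $$\left(\frac{\lambda+\varepsilon}{1+\lambda-\varepsilon}\right)^{k/2}<\frac{1}{2\sqrt2\,\mathrm{e}\,\Delta k^2}.$$ Let $\mathcal D_\varepsilon=\{z\in\mathbb C:\exists \lambda\in[0,\lambda_{c,\varepsilon}),\ |z-\lambda|\le\varepsilon\}$. Let $H=(V,\mathcal E)$ be a finite $k$-uniform hypergraph with nonempty vertex set $V=\{v_1,\dots,v_n\}$ (in any fixed order), in which every vertex lies in at most $\Delta$ hyperedges, and let $\boldsymbol\lambda=(\lambda_v)_{v\in V}\in\mathcal D_\varepsilon^V$. Let $\mathcal I(H)$ be the set of all $\sigma\in\{0,1\}^V$ such that every hyperedge contains a vertex $v$ with $\sigma(v)=0$, and let $Z=Z^{\mathrm{ly}}_H(\boldsymbol\lambda)=\sum_{\sigma\in\mathcal I(H)}\prod_{v:\sigma(v)=1}\lambda_v$.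 Then $Z\neq 0$, so the complex Gibbs measure $\mu$, given by $\mu(\sigma)=Z^{-1}\prod_{v:\sigma(v)=1}\lambda_v$ for $\sigma\in\mathcal I(H)$ and $\mu(\sigma)=0$ otherwise, is well defined and normalized ($\sum_\sigma\mu(\sigma)=1$). Write $\mathrm{supp}(\mu)=\{\sigma:\mu(\sigma)\ne0\}$. For $\sigma\in\mathrm{supp}(\mu)$ and $v\in V$, the conditional marginal measure at $v$, $$\mu_v^{\sigma(V\setminus\{v\})}(c)=\frac{\mu(\{\omega:\omega(v)=c,\ \omega=\sigma\text{ on }V\setminus\{v\}\})}{\mu(\{\omega:\omega=\sigma\text{ on }V\setminus\{v\}\})},\qquad c\in\{0,1\},$$ is well defined (its denominator is nonzero). For $t\in\mathbb Z$ let $P_t$ be the transition matrix of the systematic scan Glauber dynamics at time $t$: with $v=v_{(t\bmod n)+1}$, $P_t(\sigma,\tau)=\mu_v^{\sigma(V\setminus\{v\})}(\tau(v))$ if $\sigma=\tau$ on $V\setminus\{v\}$, and $P_t(\sigma,\tau)=0$ otherwise. Each row of $P_t$ indexed by $\sigma\in\mathrm{supp}(\mu)$ sums to $1$ and vanishes outside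 $\mathrm{supp}(\mu)$, and $\mu P_t=\mu$ for all $t$. The dynamics converges to $\mu$ from any initial state $\tau\in\mathrm{supp}(\mu)$: with $\delta_\tau$ the unit mass at $\tau$, as $T\to\infty$, $$\delta_\tau P_1P_2\cdots P_T\to\mu\qquad\text{and}\qquad \delta_\tau P_{-T+1}P_{-T+2}\cdots P_0\to\mu .$$ Moreover, for any two complex measures $\nu,\nu'$ supported on $\mathrm{supp}(\mu)$, each of total mass $1$, $$\lim_{T\to\infty}\left\|\nu P_1\cdots P_T-\nu'P_1\cdots P_T\right\|_1=0 .$$ -/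

import Mathlib

namespace ComplexGlauber

/-! ### Complex measures on a finite set -/

section Measures

variable {Ω : Type*} [Fintype Ω]

/-- A complex measure on a finite set, given by its point masses, is normalized if its total mass
is `1`. -/
def IsNormalized (μ : Ω → ℂ) : Prop := ∑ ω, μ ω = 1

open Classical in
/-- The measure `μ(A) = ∑_{ω ∈ A} μ(ω)` of an event `A`. -/
noncomputable def eventMeasure (μ : Ω → ℂ) (A : Set Ω) : ℂ :=
  ∑ ω, if ω ∈ A then μ ω else 0

/-- The conditional measure `μ(B ∣ A) = μ(B ∩ A) / μ(A)`; meaningful when `μ(A) ≠ 0`. -/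
noncomputable def condMeasure (μ : Ω → ℂ) (B A : Set Ω) : ℂ :=
  eventMeasure μ (B ∩ A) / eventMeasure μ A

open Classical in
/-- The unit mass at `τ`. -/
noncomputable def pointMass (τ : Ω) : Ω → ℂ := fun ω => if ω = τ then 1 else 0

/-- The complex measure obtained from `ν` after `m` steps of the (time-inhomogeneous) chain with
transition matrices `P t`, started at time `s`: that is `ν P_{s+1} P_{s+2} ⋯ P_{s+m}`. -/
noncomputable def evolve (P : ℤ → Matrix Ω Ω ℂ) (s : ℤ) (ν : Ω → ℂ) : ℕ → Ω → ℂ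
  | 0 => ν
  | m + 1 => Matrix.vecMul (evolve P s ν m) (P (s + m + 1))

/-- Convergence of the complex Markov chain with transition matrices `P 1, P 2, …` and state
space `S`: any two normalized complex measures on `S` become indistinguishable in `ℓ¹`-norm. -/
def IsConvergentOn (S : Set Ω) (P : ℤ → Matrix Ω Ω ℂ) : Prop :=
  ∀ ν ν' : Ω → ℂ, IsNormalized ν → IsNormalized ν' →
    Function.support ν ⊆ S → Function.support ν' ⊆ S →
    Filter.Tendsto (fun T : ℕ => ∑ ω, ‖evolve P 0 ν T ω - evolve P 0 ν' T ω‖)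
      Filter.atTop (nhds 0)

end Measures

/-! ### Systematic scan Glauber dynamics for a complex measure -/

section Glauber

variable {V α : Type*}

/-- The event that the configuration agrees with `σ` on `V ∖ {v}`. -/
def agreeOff (σ : V → α) (v : V) : Set (V → α) := {ω | ∀ u, u ≠ v → ω u = σ u}

variable [Fintype V] [DecidableEq V] [Fintype α]

/-- The marginal measure at `v` conditioned on the configuration `σ` on `V ∖ {v}`, evaluated
at `c`. -/
noncomputable def siteMarginal (μ : (V → α) → ℂ) (σ : V → α) (v : V) (c : α) : ℂ :=
  condMeasure μ {ω | ω v = c} (agreeOff σ v)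

/-- The vertex updated at time `t`: with `V = {v₁, …, vₙ}`, where `v_{j+1} = ord j`, it is
`v_{(t mod n) + 1}`. -/
def scanVertex {n : ℕ} [NeZero n] (ord : Fin n ≃ V) (t : ℤ) : V :=
  ord (Fin.ofNat n (t % (n : ℤ)).toNat)

open Classical in
/-- The transition matrix at time `t` of the complex systematic scan Glauber dynamics with target
measure `μ`. -/
noncomputable def scanMatrix {n : ℕ} [NeZero n] (ord : Fin n ≃ V) (μ : (V → α) → ℂ) (t : ℤ) :
    Matrix (V → α) (V → α) ℂ :=
  fun σ τ =>
    if ∀ u, u ≠ scanVertex ord t → σ u = τ u then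
      siteMarginal μ σ (scanVertex ord t) (τ (scanVertex ord t))
    else 0

end Glauber

/-! ### The hypergraph independence polynomial -/

section Hypergraphs

variable {V : Type*}

/-- All hyperedges have exactly `k` vertices. -/
def IsUniform (H : Hypergraph V) (k : ℕ) : Prop := ∀ e ∈ H.edgeSet, e.ncard = k

/-- Every vertex lies in at most `Δ` hyperedges (used for finite `V`). -/
def MaxDegreeLE (H : Hypergraph V) (Δ : ℕ) : Prop :=
  ∀ v ∈ H.vertexSet, {e | e ∈ H.edgeSet ∧ v ∈ e}.ncard ≤ Δ

/-- The independent sets of `H`, as `0/1` configurations: no hyperedge is entirely `1`. -/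
def indepSets (H : Hypergraph V) : Set (V → Fin 2) :=
  {σ | ∀ e ∈ H.edgeSet, ∃ v ∈ e, σ v = 0}

variable [Fintype V] [DecidableEq V]

open Classical in
/-- The weight of a configuration: `∏_{v : σ(v) = 1} lam_v` on independent sets, `0` elsewhere. -/
noncomputable def indepWeight (H : Hypergraph V) (lam : V → ℂ) (σ : V → Fin 2) : ℂ :=
  if σ ∈ indepSets H then ∏ v with σ v = 1, lam v else 0

/-- The (multivariate) independence polynomial `Z_H^{ly}`. -/
noncomputable def indepPoly (H : Hypergraph V) (lam : V → ℂ) : ℂ :=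
  ∑ σ, indepWeight H lam σ

/-- The complex Gibbs measure associated with `Z_H^{ly}`; meaningful when `Z_H^{ly} ≠ 0`. -/
noncomputable def gibbs (H : Hypergraph V) (lam : V → ℂ) : (V → Fin 2) → ℂ :=
  fun σ => indepWeight H lam σ / indepPoly H lam

end Hypergraphs

/-- The union of the closed `ε`-balls around the points of the real segment `[0, lc)`. -/
def lyRegion (ε lc : ℝ) : Set ℂ := {z | ∃ x : ℝ, 0 ≤ x ∧ x < lc ∧ ‖z - (x : ℂ)‖ ≤ ε}

end ComplexGlauber

/-! Put q_v = λ_v/(1+λ_v). Resampling v from its conditional marginal amounts to attempting, with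
complex probability q_v, to occupy v, which succeeds unless some hyperedge at v is otherwise fully
occupied; in all other cases v becomes vacant. The law after m updates is thus a complex-weighted
sum over the set r of attempt times, the weight being a product of factors q and 1 - q. At each time
these factors sum to 1, so times on which the summand does not depend drop out before absolute
values are taken.

Replacing each vertex of a hyperedge by the time of its last update gives space-time hyperedges,
each meeting at most D = Δk² of them. One that is not open, that is, not contained in r, has a
vacant vertex and cannot block. Hence the final configuration is determined by the open cluster of
the last n times together with its neighbourhood, and the initial configuration matters only if this
cluster reaches back to the start. A cluster contains a skeleton of pairwise disjoint open
hyperedges, each costing at most p^k B^(D²k), where p bounds |q| and B bounds |q| + |1 - q|. Summing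
over skeletons (`sum_rootedSets_le`) shows that the initial configuration is forgotten exponentially
fast (`norm_expect_sub_le`) and that, from the empty configuration, a hyperedge is rarely full
(`norm_expect_edge_le`).

Neither estimate presupposes Z ≠ 0. That follows by adding hyperedges one at a time: Z(E ∪ {e}) =
Z(E)(1 - μ_E(e full)), and by stationarity and forgetting, μ_E(e full) is arbitrarily close to an
expectation from the empty configuration, of modulus at most 1/2. Once Z ≠ 0, the scan matrices
agree with the attempt kernels on the support of μ, and forgetting, uniform in the starting time,
gives every convergence claim. -/

namespace ComplexGlauber

/-! ### Counting sets connected to given roots -/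

section Reach

variable {ι : Type*}

/-- The elements of `S` that are reachable from `R ∩ S` by steps inside `S` along `adj`. -/
inductive ReachIn (adj : ι → ι → Prop) (R S : Set ι) : ι → Prop
  | root {h : ι} : h ∈ R → h ∈ S → ReachIn adj R S h
  | step {a b : ι} : ReachIn adj R S a → adj a b → b ∈ S → ReachIn adj R S b

theorem ReachIn.mem {adj : ι → ι → Prop} {R S : Set ι} {h : ι} (hh : ReachIn adj R S h) :
    h ∈ S := by
  cases hh <;> assumption

theorem ReachIn.mono {adj : ι → ι → Prop} {R R' S S' : Set ι} (hR : R ⊆ R') (hS : S ⊆ S') {h : ι}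
    (hh : ReachIn adj R S h) : ReachIn adj R' S' h := by
  induction hh with
  | root h1 h2 => exact .root (hR h1) (hS h2)
  | step _ h2 h3 ih => exact .step ih h2 (hS h3)

/-- A path to `h` can be restarted just after its last visit to `u`; hence the neighbours of `u`
become roots once `u` is removed. -/
theorem ReachIn.erase {adj : ι → ι → Prop} {R S : Set ι} {u h : ι} (hh : ReachIn adj R S h) :
    h = u ∨ ReachIn adj ((R \ {u}) ∪ {x | x ∈ S \ {u} ∧ adj u x}) (S \ {u}) h := by
  induction hh with
  | @root h h1 h2 =>
    by_cases hu : h = u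
    · exact .inl hu
    · exact .inr (.root (.inl ⟨h1, hu⟩) ⟨h2, hu⟩)
  | @step a b _ h2 h3 ih =>
    by_cases hu : b = u
    · exact .inl hu
    · right
      rcases ih with rfl | ih
      · exact .root (.inr ⟨⟨h3, hu⟩, h2⟩) ⟨h3, hu⟩
      · exact .step ih h2 ⟨h3, hu⟩

/-- Discrete intermediate value property along a chain whose steps change `b` by at most one. -/
theorem ReachIn.exists_level {adj : ι → ι → Prop} {R S : Set ι} {h : ι} (b : ι → ℤ)
    (hb : ∀ x ∈ S, ∀ y ∈ S, adj x y → b x ≤ b y + 1) {m : ℤ} (hm : ∀ x ∈ R, m ≤ b x)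
    (hh : ReachIn adj R S h) : ∀ i, b h ≤ i → i ≤ m → ∃ x ∈ S, b x = i := by
  induction hh with
  | @root h h1 h2 =>
    intro i hi hi'
    exact ⟨h, h2, le_antisymm hi (hi'.trans (hm h h1))⟩
  | @step a c h1 h2 h3 ih =>
    intro i hi hi'
    by_cases hc : b c = i
    · exact ⟨c, h3, hc⟩
    · have := hb a h1.mem c h3 h2
      exact ih i (by omega) hi'

theorem sum_biUnion_le_of_nonneg {α β : Type*} [DecidableEq β] (s : Finset α) (t : α → Finset β)
    (f : β → ℝ) (hf : ∀ b, 0 ≤ f b) : ∑ b ∈ s.biUnion t, f b ≤ ∑ a ∈ s, ∑ b ∈ t a, f b := by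
  classical
  induction s using Finset.induction_on with
  | empty => simp
  | insert a s ha ih =>
    rw [Finset.biUnion_insert, Finset.sum_insert ha]
    have := Finset.sum_union_inter (s₁ := t a) (s₂ := s.biUnion t) (f := f)
    have h2 : 0 ≤ ∑ b ∈ t a ∩ s.biUnion t, f b := Finset.sum_nonneg fun b _ => hf b
    linarith

open Classical in
/-- The finite subsets of `Λ` that contain `U` and all of whose elements are reachable from `U`. -/
noncomputable def rootedSets (adj : ι → ι → Prop) (Λ U : Finset ι) : Finset (Finset ι) :=
  {T ∈ Λ.powerset | U ⊆ T ∧ ∀ h ∈ T, ReachIn adj (U : Set ι) (T : Set ι) h}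

-- Remove one root `u`, at cost `z`. Each of its at most `N` new neighbours either becomes a root,
-- contributing a factor `a` by induction, or is left out, contributing 1. This produces `z * (1 +
-- a) ^ N`, which by hypothesis is at most the factor `a` owed for `u`.
open Classical in
theorem sum_rootedSets_le {adj : ι → ι → Prop} {N : ℕ} {z a : ℝ} (hz : 0 ≤ z) (ha : 0 ≤ a)
    (hza : z * (1 + a) ^ N ≤ a) (Λ U : Finset ι) (hN : ∀ u ∈ Λ, {x ∈ Λ | adj u x}.card ≤ N) :
    ∑ T ∈ rootedSets adj Λ U, z ^ T.card ≤ a ^ U.card := by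
  induction hn : Λ.card generalizing Λ U with
  | zero =>
    obtain rfl : Λ = ∅ := Finset.card_eq_zero.1 hn
    by_cases hU : U = ∅
    · subst hU
      have : rootedSets adj (∅ : Finset ι) ∅ ⊆ {∅} := by
        intro T
        simp only [rootedSets, Finset.mem_filter, Finset.mem_powerset, Finset.subset_empty,
          Finset.mem_singleton]
        exact fun h => h.1
      refine (Finset.sum_le_sum_of_subset_of_nonneg this fun _ _ _ => by positivity).trans ?_
      simp
    · have : rootedSets adj (∅ : Finset ι) U = ∅ := by
        ext T
        simp only [rootedSets, Finset.mem_filter, Finset.mem_powerset, Finset.subset_empty]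
        constructor
        · rintro ⟨rfl, h, -⟩
          exact absurd (Finset.subset_empty.1 h) hU
        · simp
      rw [this]; simpa using pow_nonneg ha _
  | succ n ih =>
    rcases U.eq_empty_or_nonempty with rfl | ⟨u, hu⟩
    · have : rootedSets adj Λ ∅ ⊆ {∅} := by
        intro T
        simp only [rootedSets, Finset.mem_filter, Finset.mem_singleton]
        rintro ⟨-, -, h⟩
        refine Finset.eq_empty_of_forall_notMem fun x hx => ?_
        have := h x hx
        induction this with
        | root h => simp at h
        | step h _ _ ih => exact ih h.mem
      refine (Finset.sum_le_sum_of_subset_of_nonneg this fun _ _ _ => by positivity).trans ?_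
      simp
    by_cases huΛ : u ∈ Λ
    swap
    · have : rootedSets adj Λ U = ∅ := by
        refine Finset.eq_empty_of_forall_notMem fun T hT => ?_
        simp only [rootedSets, Finset.mem_filter, Finset.mem_powerset] at hT
        exact huΛ (hT.1 (hT.2.1 hu))
      rw [this]; simpa using pow_nonneg ha _
    set Nb : Finset ι := {x ∈ Λ.erase u | adj u x} \ U with hNb
    have hNbc : Nb.card ≤ N := by
      refine le_trans (Finset.card_le_card ?_) (hN u huΛ)
      intro x
      simp only [hNb, Finset.mem_sdiff, Finset.mem_filter, Finset.mem_erase]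
      tauto
    have hcov : rootedSets adj Λ U ⊆ Nb.powerset.biUnion fun S =>
        (rootedSets adj (Λ.erase u) (U.erase u ∪ S)).image (insert u) := by
      intro T hT
      simp only [rootedSets, Finset.mem_filter, Finset.mem_powerset] at hT
      obtain ⟨hTΛ, hUT, hreach⟩ := hT
      simp only [Finset.mem_biUnion, Finset.mem_image, Finset.mem_powerset]
      -- The new roots are the neighbours of `u` in `T` that were not roots already; keeping them
      -- disjoint from `U` makes the exponents of `a` add up.
      refine ⟨{x ∈ T.erase u | adj u x} \ U, ?_, T.erase u, ?_, Finset.insert_erase (hUT hu)⟩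
      · intro x
        simp only [hNb, Finset.mem_sdiff, Finset.mem_filter, Finset.mem_erase]
        rintro ⟨⟨⟨h1, h2⟩, h3⟩, h4⟩
        exact ⟨⟨⟨h1, hTΛ h2⟩, h3⟩, h4⟩
      · simp only [rootedSets, Finset.mem_filter, Finset.mem_powerset]
        refine ⟨Finset.erase_subset_erase _ hTΛ, ?_, ?_⟩
        · intro x
          simp only [Finset.mem_union, Finset.mem_sdiff, Finset.mem_filter, Finset.mem_erase]
          rintro (⟨h1, h2⟩ | ⟨⟨h, -⟩, -⟩)
          · exact ⟨h1, hUT h2⟩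
          · exact h
        · intro h hh
          rw [Finset.mem_erase] at hh
          rcases (hreach h hh.2).erase (u := u) with h1 | h1
          · exact absurd h1 hh.1
          · refine h1.mono ?_ ?_
            · rintro x (⟨h2, h3⟩ | ⟨⟨h2, h3⟩, h4⟩)
              · simp only [Finset.coe_union, Set.mem_union, Finset.mem_coe, Finset.mem_erase]
                exact .inl ⟨h3, h2⟩
              · simp only [Finset.coe_union, Set.mem_union, Finset.mem_coe, Finset.mem_erase,
                  Finset.mem_sdiff, Finset.mem_filter]
                by_cases hxU : x ∈ U
                · exact .inl ⟨h3, hxU⟩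
                · exact .inr ⟨⟨⟨h3, h2⟩, h4⟩, hxU⟩
            · rintro x ⟨h2, h3⟩
              simp only [Finset.mem_coe, Finset.mem_erase]
              exact ⟨h3, h2⟩
    have hstep : ∀ S ∈ Nb.powerset,
        ∑ T ∈ (rootedSets adj (Λ.erase u) (U.erase u ∪ S)).image (insert u), z ^ T.card
          ≤ z * a ^ (U.card - 1) * a ^ S.card := by
      intro S hS
      have hnot : ∀ T ∈ rootedSets adj (Λ.erase u) (U.erase u ∪ S), u ∉ T := by
        intro T hT
        simp only [rootedSets, Finset.mem_filter, Finset.mem_powerset] at hT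
        exact fun h => by simpa using hT.1 h
      rw [Finset.sum_image]
      · have h1 : ∀ T ∈ rootedSets adj (Λ.erase u) (U.erase u ∪ S),
            z ^ (insert u T).card = z * z ^ T.card := by
          intro T hT
          rw [Finset.card_insert_of_notMem (hnot T hT), pow_succ']
        rw [Finset.sum_congr rfl h1, ← Finset.mul_sum, mul_assoc]
        refine mul_le_mul_of_nonneg_left ?_ hz
        have := ih (Λ.erase u) (U.erase u ∪ S) ?_ ?_
        · refine this.trans (le_of_eq ?_)
          rw [Finset.card_union_of_disjoint, Finset.card_erase_of_mem hu, pow_add]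
          rw [Finset.disjoint_left]
          intro x hx hxS
          have := Finset.mem_powerset.1 hS hxS
          simp only [hNb, Finset.mem_sdiff] at this
          exact this.2 (Finset.mem_of_mem_erase hx)
        · intro x hx
          refine le_trans (Finset.card_le_card ?_) (hN x (Finset.mem_of_mem_erase hx))
          exact Finset.filter_subset_filter _ (Finset.erase_subset _ _)
        · rw [Finset.card_erase_of_mem huΛ, hn]; rfl
      · intro T hT T' hT' h
        have h' : insert u T = insert u T' := h
        rw [← Finset.erase_insert (hnot T hT), h', Finset.erase_insert (hnot T' hT')]
    calc ∑ T ∈ rootedSets adj Λ U, z ^ T.card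
        ≤ ∑ T ∈ Nb.powerset.biUnion fun S =>
            (rootedSets adj (Λ.erase u) (U.erase u ∪ S)).image (insert u), z ^ T.card :=
          Finset.sum_le_sum_of_subset_of_nonneg hcov fun _ _ _ => by positivity
      _ ≤ ∑ S ∈ Nb.powerset, ∑ T ∈ (rootedSets adj (Λ.erase u) (U.erase u ∪ S)).image (insert u),
            z ^ T.card := sum_biUnion_le_of_nonneg _ _ _ fun _ => by positivity
      _ ≤ ∑ S ∈ Nb.powerset, z * a ^ (U.card - 1) * a ^ S.card := Finset.sum_le_sum hstep
      _ = z * a ^ (U.card - 1) * (1 + a) ^ Nb.card := by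
          rw [← Finset.mul_sum, add_comm 1 a, ← Finset.sum_pow_mul_eq_add_pow]
          simp
      _ ≤ z * a ^ (U.card - 1) * (1 + a) ^ N := by
          refine mul_le_mul_of_nonneg_left ?_ (by positivity)
          exact pow_le_pow_right₀ (by linarith) hNbc
      _ = a ^ (U.card - 1) * (z * (1 + a) ^ N) := by ring
      _ ≤ a ^ (U.card - 1) * a := mul_le_mul_of_nonneg_left hza (by positivity)
      _ = a ^ U.card := by
          rw [← pow_succ, Nat.sub_add_cancel (Finset.card_pos.2 ⟨u, hu⟩)]

open Classical in
/-- The subsets of `Λ` all of whose elements are reachable from `R`. -/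
noncomputable def reachSets (adj : ι → ι → Prop) (Λ R : Finset ι) : Finset (Finset ι) :=
  {T ∈ Λ.powerset | ∀ h ∈ T, ReachIn adj (R : Set ι) (T : Set ι) h}

-- Sort the sets by the roots they contain, `U = R ∩ T`; the bounds `a ^ U.card` add up by the
-- binomial theorem.
open Classical in
theorem sum_reachSets_le {adj : ι → ι → Prop} {N : ℕ} {z a : ℝ} (hz : 0 ≤ z) (ha : 0 ≤ a)
    (hza : z * (1 + a) ^ N ≤ a) (Λ R : Finset ι) (hN : ∀ u ∈ Λ, {x ∈ Λ | adj u x}.card ≤ N) :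
    ∑ T ∈ reachSets adj Λ R, z ^ T.card ≤ (1 + a) ^ R.card := by
  have hcov : reachSets adj Λ R ⊆ R.powerset.biUnion fun U => rootedSets adj Λ U := by
    intro T hT
    simp only [reachSets, Finset.mem_filter, Finset.mem_powerset] at hT
    simp only [Finset.mem_biUnion, Finset.mem_powerset, rootedSets, Finset.mem_filter]
    refine ⟨R ∩ T, Finset.inter_subset_left, hT.1, Finset.inter_subset_right, fun h hh => ?_⟩
    have := hT.2 h hh
    induction this with
    | root h1 h2 => exact .root (by simpa using ⟨h1, h2⟩) h2
    | step h1 h2 h3 ih => exact .step (ih h1.mem) h2 h3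
  calc _ ≤ ∑ T ∈ R.powerset.biUnion fun U => rootedSets adj Λ U, z ^ T.card :=
          Finset.sum_le_sum_of_subset_of_nonneg hcov fun _ _ _ => by positivity
    _ ≤ ∑ U ∈ R.powerset, ∑ T ∈ rootedSets adj Λ U, z ^ T.card :=
          sum_biUnion_le_of_nonneg _ _ _ fun _ => by positivity
    _ ≤ ∑ U ∈ R.powerset, a ^ U.card :=
          Finset.sum_le_sum fun U _ => sum_rootedSets_le hz ha hza Λ U hN
    _ = (1 + a) ^ R.card := by
          rw [add_comm 1 a, ← Finset.sum_pow_mul_eq_add_pow]; simp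

end Reach

/-! ### Complex product weights and local sums -/

section Weights

variable {P : Type*} [DecidableEq P]

/-- The complex product weight of `r ⊆ X`, with weight `q x` for `x ∈ r` and `1 - q x` for
`x ∉ r`. -/
noncomputable def prodWeight (q : P → ℂ) (X r : Finset P) : ℂ :=
  ∏ x ∈ X, if x ∈ r then q x else 1 - q x

theorem prodWeight_insert_left (q : P → ℂ) {X r : Finset P} {y : P} (hy : y ∉ X) (hr : r ⊆ X) :
    prodWeight q (insert y X) r = (1 - q y) * prodWeight q X r := by
  rw [prodWeight, Finset.prod_insert hy, if_neg (fun h => hy (hr h)), prodWeight]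

theorem prodWeight_insert_insert (q : P → ℂ) {X r : Finset P} {y : P} (hy : y ∉ X) :
    prodWeight q (insert y X) (insert y r) = q y * prodWeight q X r := by
  rw [prodWeight, Finset.prod_insert hy, if_pos (Finset.mem_insert_self _ _), prodWeight]
  congr 1
  refine Finset.prod_congr rfl fun x hx => ?_
  have : x ≠ y := fun h => hy (h ▸ hx)
  simp [this]

theorem sum_prodWeight_insert (q : P → ℂ) {X : Finset P} {y : P} (hy : y ∉ X)
    (f : Finset P → ℂ) :
    ∑ r ∈ (insert y X).powerset, prodWeight q (insert y X) r * f r =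
      ∑ r ∈ X.powerset, prodWeight q X r * ((1 - q y) * f r + q y * f (insert y r)) := by
  rw [Finset.sum_powerset_insert hy, ← Finset.sum_add_distrib]
  refine Finset.sum_congr rfl fun r hr => ?_
  rw [prodWeight_insert_left q hy (Finset.mem_powerset.1 hr), prodWeight_insert_insert q hy]
  ring

/-- The factors `q y` and `1 - q y` sum to 1, so an irrelevant point can be summed out exactly. This
substitutes for independence and avoids paying a factor `B` at every point. -/
theorem sum_prodWeight_of_local (q : P → ℂ) {A X : Finset P} (hA : A ⊆ X) (f : Finset P → ℂ)
    (hf : ∀ r ⊆ X, f r = f (r ∩ A)) :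
    ∑ r ∈ X.powerset, prodWeight q X r * f r = ∑ r ∈ A.powerset, prodWeight q A r * f r := by
  obtain ⟨Y, hY, rfl⟩ : ∃ Y, Disjoint A Y ∧ X = A ∪ Y :=
    ⟨X \ A, Finset.disjoint_sdiff, (Finset.union_sdiff_of_subset hA).symm⟩
  clear hA
  induction Y using Finset.induction_on with
  | empty => simp
  | insert y Y hyY ih =>
    rw [Finset.disjoint_insert_right] at hY
    have hy : y ∉ A ∪ Y := by simp [hY.1, hyY]
    rw [Finset.union_insert] at hf ⊢
    rw [sum_prodWeight_insert q hy, ← ih hY.2 fun r hr => hf r (hr.trans (Finset.subset_insert _ _))]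
    refine Finset.sum_congr rfl fun r hr => ?_
    rw [Finset.mem_powerset] at hr
    rw [hf (insert y r) (Finset.insert_subset_insert _ hr), Finset.insert_inter_of_notMem hY.1,
      ← hf r (hr.trans (Finset.subset_insert _ _))]
    ring

/-- Points outside `A` are summed out first; only then does the triangle inequality apply. A point
of `O` is forced into `r` and costs `p`, any other point of `A` costs `B`. -/
theorem norm_sum_prodWeight_le (q : P → ℂ) {p B : ℝ} {X : Finset P} (hp : ∀ x ∈ X, ‖q x‖ ≤ p)
    (hB : ∀ x ∈ X, ‖q x‖ + ‖1 - q x‖ ≤ B) (hB1 : 1 ≤ B) {A O : Finset P}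
    (f : Finset P → ℂ) (hf : ∀ r ⊆ X, f r = f (r ∩ A)) (hf1 : ∀ r, ‖f r‖ ≤ 1)
    (hfO : ∀ r ⊆ X, f r ≠ 0 → O ⊆ r) (hOA : O ⊆ A) (hOX : O ⊆ X) :
    ‖∑ r ∈ X.powerset, prodWeight q X r * f r‖ ≤ p ^ O.card * B ^ A.card := by
  have hAX : A ∩ X ⊆ X := Finset.inter_subset_right
  rw [sum_prodWeight_of_local q hAX f]
  swap
  · intro r hr
    rw [hf r hr, hf (r ∩ (A ∩ X)) (Finset.inter_subset_left.trans hr)]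
    congr 1
    ext x
    simp only [Finset.mem_inter]
    have := @hr x
    tauto
  have hOAX : O ⊆ A ∩ X := Finset.subset_inter hOA hOX
  have key : ∀ r ∈ (A ∩ X).powerset, ‖prodWeight q (A ∩ X) r * f r‖ ≤
      ∏ x ∈ A ∩ X, if x ∈ r then ‖q x‖ else (if x ∈ O then 0 else ‖1 - q x‖) := by
    intro r hr
    rw [Finset.mem_powerset] at hr
    by_cases h0 : f r = 0
    · rw [h0, mul_zero, norm_zero]
      exact Finset.prod_nonneg fun x _ => by split_ifs <;> positivity
    have hO := hfO r (hr.trans hAX) h0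
    rw [norm_mul]
    refine (mul_le_of_le_one_right (norm_nonneg _) (hf1 r)).trans (le_of_eq ?_)
    rw [prodWeight, norm_prod]
    refine Finset.prod_congr rfl fun x _ => ?_
    split_ifs with h1 h2
    · rfl
    · exact absurd (hO h2) h1
    · rfl
  calc ‖∑ r ∈ (A ∩ X).powerset, prodWeight q (A ∩ X) r * f r‖
      ≤ ∑ r ∈ (A ∩ X).powerset,
        ∏ x ∈ A ∩ X, if x ∈ r then ‖q x‖ else (if x ∈ O then 0 else ‖1 - q x‖) :=
        (norm_sum_le _ _).trans (Finset.sum_le_sum key)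
    _ = ∏ x ∈ A ∩ X, (‖q x‖ + if x ∈ O then 0 else ‖1 - q x‖) := by
        rw [Finset.prod_add]
        refine Finset.sum_congr rfl fun r hr => ?_
        rw [Finset.mem_powerset] at hr
        rw [Finset.prod_ite]
        congr 1
        · congr 1
          ext x; simp only [Finset.mem_filter]; exact ⟨fun h => h.2, fun h => ⟨hr h, h⟩⟩
        · congr 1
          ext x; simp
    _ ≤ ∏ x ∈ A ∩ X, if x ∈ O then p else B := by
        refine Finset.prod_le_prod (fun x _ => by split_ifs <;> positivity) fun x hx => ?_
        have hxX := hAX hx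
        split_ifs
        · simpa using hp x hxX
        · exact hB x hxX
    _ = p ^ O.card * B ^ ((A ∩ X) \ O).card := by
        rw [Finset.prod_ite, Finset.prod_const, Finset.prod_const]
        congr 2
        · congr 1
          ext x; simp only [Finset.mem_filter]; exact ⟨fun h => h.2, fun h => ⟨hOAX h, h⟩⟩
        · congr 1
          ext x; simp
    _ ≤ p ^ O.card * B ^ A.card := by
        by_cases hOe : O = ∅
        · subst hOe
          simp only [Finset.card_empty, pow_zero, one_mul]
          exact pow_le_pow_right₀ hB1 (Finset.card_le_card (Finset.sdiff_subset.trans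
            Finset.inter_subset_left))
        · obtain ⟨x, hx⟩ := Finset.nonempty_of_ne_empty hOe
          have hp0 : 0 ≤ p := (norm_nonneg _).trans (hp x (hOX hx))
          refine mul_le_mul_of_nonneg_left ?_ (by positivity)
          exact pow_le_pow_right₀ hB1 (Finset.card_le_card (Finset.sdiff_subset.trans
            Finset.inter_subset_left))

/-- If a complex weighted sum can be split according to the value of a statistic `T`, where the
event `T = t` and the summand on it depend only on `r ∩ A t` and force `O t ⊆ r`, then it is
bounded by the sum of the local bounds. -/
theorem norm_sum_prodWeight_le_sum {κ : Type*} [DecidableEq κ] (q : P → ℂ) {p B : ℝ}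
    {X : Finset P} (hp : ∀ x ∈ X, ‖q x‖ ≤ p) (hp0 : 0 ≤ p)
    (hB : ∀ x ∈ X, ‖q x‖ + ‖1 - q x‖ ≤ B) (hB1 : 1 ≤ B) (T : Finset P → κ)
    (A O : κ → Finset P) (f : Finset P → ℂ) (hf1 : ∀ r, ‖f r‖ ≤ 1) (hOA : ∀ r ⊆ X, O (T r) ⊆ A (T r))
    (hloc : ∀ r ⊆ X, ∀ r' ⊆ X, r ∩ A (T r) = r' ∩ A (T r) → T r' = T r ∧ f r' = f r)
    (hO : ∀ r ⊆ X, O (T r) ⊆ r) (𝓣 : Finset κ) (h𝓣 : ∀ r ⊆ X, f r ≠ 0 → T r ∈ 𝓣) :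
    ‖∑ r ∈ X.powerset, prodWeight q X r * f r‖ ≤
      ∑ t ∈ 𝓣, p ^ (O t).card * B ^ (A t).card := by
  have hsplit : ∑ r ∈ X.powerset, prodWeight q X r * f r =
      ∑ t ∈ 𝓣, ∑ r ∈ X.powerset, prodWeight q X r * (if T r = t then f r else 0) := by
    rw [Finset.sum_comm]
    refine Finset.sum_congr rfl fun r hr => ?_
    rw [← Finset.mul_sum, Finset.sum_ite_eq]
    split_ifs with h
    · rfl
    · rw [not_imp_comm.1 (h𝓣 r (Finset.mem_powerset.1 hr)) h]
  rw [hsplit]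
  refine (norm_sum_le _ _).trans (Finset.sum_le_sum fun t _ => ?_)
  by_cases hex : ∃ r ⊆ X, T r = t
  · obtain ⟨r₀, hr₀, rfl⟩ := hex
    refine norm_sum_prodWeight_le q hp hB hB1 _ ?_ ?_ ?_ (hOA r₀ hr₀) ((hO r₀ hr₀).trans hr₀)
    -- The event `T r = T r₀` is itself decided by `r ∩ A (T r₀)`: apply `hloc` from `r` to its
    -- restriction, and in the opposite direction.
    · intro r hr
      have hr' : r ∩ A (T r₀) ⊆ X := Finset.inter_subset_left.trans hr
      have e1 : (r ∩ A (T r₀)) ∩ A (T r₀) = r ∩ A (T r₀) := by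
        rw [Finset.inter_assoc, Finset.inter_self]
      by_cases h : T r = T r₀
      · have := hloc r hr _ hr' (by rw [h, e1])
        rw [if_pos h, if_pos (this.1.trans h), this.2]
      · by_cases h' : T (r ∩ A (T r₀)) = T r₀
        · have := hloc _ hr' r hr (by rw [h', e1])
          exact absurd (this.1.trans h') h
        · rw [if_neg h, if_neg h']
    · intro r
      split_ifs
      · exact hf1 r
      · simp
    · intro r hr h
      split_ifs at h with h1
      · rw [← h1]; exact hO r hr
      · exact absurd rfl h
  · have : ∑ r ∈ X.powerset, prodWeight q X r * (if T r = t then f r else 0) = 0 := by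
      refine Finset.sum_eq_zero fun r hr => ?_
      rw [if_neg fun h => hex ⟨r, Finset.mem_powerset.1 hr, h⟩, mul_zero]
    rw [this, norm_zero]
    positivity

end Weights
-- Open clusters and their skeletons
section Clusters

variable {ι P : Type*}

/-- Two indices meet if their point sets intersect. -/
def Meets (pts : ι → Finset P) (a b : ι) : Prop := ¬ Disjoint (pts a) (pts b)

theorem Meets.symm {pts : ι → Finset P} {a b : ι} (h : Meets pts a b) : Meets pts b a :=
  fun h' => h h'.symm

theorem meets_iff {pts : ι → Finset P} {a b : ι} :
    Meets pts a b ↔ ∃ x, x ∈ pts a ∧ x ∈ pts b := by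
  rw [Meets, Finset.not_disjoint_iff]

/-- Two indices are linked if they meet a common index of `𝓗`. -/
def Linked (pts : ι → Finset P) (𝓗 : Finset ι) (a b : ι) : Prop :=
  ∃ c ∈ 𝓗, Meets pts a c ∧ Meets pts c b

open Classical in
/-- The indices of `𝓗` that are open in `r` (their points all lie in `r`) and connected to `R`
through open indices. -/
noncomputable def cluster (pts : ι → Finset P) (𝓗 R : Finset ι) (r : Finset P) : Finset ι :=
  {h ∈ 𝓗 | ReachIn (Meets pts) (R : Set ι) {h | h ∈ 𝓗 ∧ pts h ⊆ r} h}

variable {pts : ι → Finset P} {𝓗 R : Finset ι} {r r' : Finset P}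

theorem mem_cluster {h : ι} : h ∈ cluster pts 𝓗 R r ↔
    ReachIn (Meets pts) (R : Set ι) {h | h ∈ 𝓗 ∧ pts h ⊆ r} h := by
  classical
  rw [cluster, Finset.mem_filter]
  exact ⟨fun h => h.2, fun h => ⟨h.mem.1, h⟩⟩

theorem cluster_subset : cluster pts 𝓗 R r ⊆ 𝓗 := by
  classical
  exact Finset.filter_subset _ _

theorem pts_subset_of_mem_cluster {h : ι} (hh : h ∈ cluster pts 𝓗 R r) : pts h ⊆ r :=
  (mem_cluster.1 hh).mem.2

theorem mem_cluster_of_root {h : ι} (h𝓗 : h ∈ 𝓗) (hR : h ∈ R) (hr : pts h ⊆ r) :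
    h ∈ cluster pts 𝓗 R r :=
  mem_cluster.2 (.root hR ⟨h𝓗, hr⟩)

theorem mem_cluster_of_meets {a h : ι} (ha : a ∈ cluster pts 𝓗 R r) (hah : Meets pts a h)
    (h𝓗 : h ∈ 𝓗) (hr : pts h ⊆ r) : h ∈ cluster pts 𝓗 R r :=
  mem_cluster.2 (.step (mem_cluster.1 ha) hah ⟨h𝓗, hr⟩)

/-- A skeleton of `C`: a subset of pairwise disjoint elements, connected to the roots through
links, and met by every element of `C`. -/
structure IsSkeleton (pts : ι → Finset P) (𝓗 R C T : Finset ι) : Prop where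
  subset : T ⊆ C
  disjoint : (T : Set ι).PairwiseDisjoint pts
  reach : ∀ h ∈ T, ReachIn (Linked pts 𝓗) (R : Set ι) (T : Set ι) h
  cover : ∀ h ∈ C, ∃ t ∈ T, Meets pts t h

/-- A disjoint, link-connected subset of the cluster of maximal cardinality works: an element met by
none of its members could be added. -/
theorem exists_isSkeleton (hne : ∀ h ∈ 𝓗, (pts h).Nonempty) (r : Finset P) :
    ∃ T, IsSkeleton pts 𝓗 R (cluster pts 𝓗 R r) T := by
  classical
  set C := cluster pts 𝓗 R r with hC
  let 𝓕 : Finset (Finset ι) := {T ∈ C.powerset | (T : Set ι).PairwiseDisjoint pts ∧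
    ∀ h ∈ T, ReachIn (Linked pts 𝓗) (R : Set ι) (T : Set ι) h}
  have h𝓕 : 𝓕.Nonempty := ⟨∅, by simp [𝓕]⟩
  obtain ⟨T, hT, hmax⟩ := Finset.exists_max_image 𝓕 Finset.card h𝓕
  simp only [𝓕, Finset.mem_filter, Finset.mem_powerset] at hT hmax
  have key : ∀ h ∈ C, (∀ t ∈ T, ¬ Meets pts t h) →
      ReachIn (Linked pts 𝓗) (R : Set ι) (insert h T : Finset ι) h → False := by
    intro h hh hdis hreach
    have hhT : h ∉ T := fun h' => by
      obtain ⟨x, hx⟩ := hne h (cluster_subset hh)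
      exact hdis h h' (meets_iff.2 ⟨x, hx, hx⟩)
    have := hmax (insert h T) ⟨Finset.insert_subset hh hT.1, ?_, ?_⟩
    · rw [Finset.card_insert_of_notMem hhT] at this
      omega
    · rw [Finset.coe_insert]
      refine hT.2.1.insert fun j hj _ => ?_
      exact (not_not.1 (hdis j hj)).symm
    · intro h' hh'
      rcases Finset.mem_insert.1 hh' with rfl | h1
      · exact hreach
      · exact (hT.2.2 h' h1).mono subset_rfl (by simp)
  refine ⟨T, hT.1, hT.2.1, hT.2.2, fun h hh => ?_⟩
  have hh' := mem_cluster.1 hh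
  induction hh' with
  | root h1 h2 =>
    by_contra! hcon
    exact key _ hh hcon (.root h1 (by simp))
  | @step a b h1 h2 h3 ih =>
    -- Since `t` meets `a` and `a` meets `b`, `t` is linked to `b`; were `b` uncovered, it could be
    -- added to `T`.
    obtain ⟨t, ht, hta⟩ := ih (mem_cluster.2 h1)
    by_contra! hcon
    exact key _ hh hcon (.step ((hT.2.2 t ht).mono subset_rfl (by simp))
      ⟨a, h1.mem.1, hta, h2⟩ (by simp))

open Classical in
theorem card_linked_le {D : ℕ} (hD : ∀ h ∈ 𝓗, {x ∈ 𝓗 | Meets pts h x}.card ≤ D) {u : ι}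
    (hu : u ∈ 𝓗) : {x ∈ 𝓗 | Linked pts 𝓗 u x}.card ≤ D ^ 2 := by
  have hsub : {x ∈ 𝓗 | Linked pts 𝓗 u x} ⊆
      {x ∈ 𝓗 | Meets pts u x}.biUnion fun c => {x ∈ 𝓗 | Meets pts c x} := by
    intro x
    simp only [Finset.mem_filter, Finset.mem_biUnion]
    rintro ⟨hx, c, hc, h1, h2⟩
    exact ⟨c, ⟨hc, h1⟩, hx, h2⟩
  refine (Finset.card_le_card hsub).trans ?_
  refine (Finset.card_biUnion_le_card_mul _ _ D fun c hc => hD c (Finset.mem_filter.1 hc).1).trans ?_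
  rw [pow_two]
  exact Nat.mul_le_mul_right _ (hD u hu)

variable [DecidableEq P]

theorem subset_iff_of_inter_eq {u : Finset P} (h : r ∩ u = r' ∩ u) : u ⊆ r ↔ u ⊆ r' := by
  rw [← Finset.inter_eq_right, h, Finset.inter_eq_right]

/-- Exploring the cluster from its roots only inspects the roots and the indices meeting the part
already found, where `r` and `r'` agree. -/
theorem cluster_congr (hR : ∀ h ∈ R, r ∩ pts h = r' ∩ pts h)
    (hC : ∀ c ∈ cluster pts 𝓗 R r, ∀ h ∈ 𝓗, Meets pts c h → r ∩ pts h = r' ∩ pts h) :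
    cluster pts 𝓗 R r' = cluster pts 𝓗 R r := by
  ext h
  constructor <;> intro hh <;> rw [mem_cluster] at hh
  · induction hh with
    | root h1 h2 =>
      exact mem_cluster_of_root h2.1 h1
        ((subset_iff_of_inter_eq (hR _ h1)).2 h2.2)
    | step _ h2 h3 ih =>
      exact mem_cluster_of_meets ih h2 h3.1
        ((subset_iff_of_inter_eq (hC _ ih _ h3.1 h2)).2 h3.2)
  · induction hh with
    | root h1 h2 =>
      exact mem_cluster_of_root h2.1 h1
        ((subset_iff_of_inter_eq (hR _ h1)).1 h2.2)
    | step h1 h2 h3 ih =>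
      exact mem_cluster_of_meets ih h2 h3.1
        ((subset_iff_of_inter_eq (hC _ (mem_cluster.2 h1) _ h3.1 h2)).1 h3.2)

variable [DecidableEq ι]

open Classical in
/-- The expansion over skeletons: a complex weighted sum whose summand depends only on the
neighbourhood of the open cluster and on `r ∩ L` is bounded by a sum over rooted sets. -/
theorem norm_sum_prodWeight_le_reachSets (q : P → ℂ) {p B : ℝ} {X : Finset P}
    (hp : ∀ x ∈ X, ‖q x‖ ≤ p) (hp0 : 0 ≤ p) (hB : ∀ x ∈ X, ‖q x‖ + ‖1 - q x‖ ≤ B) (hB1 : 1 ≤ B)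
    {k D : ℕ} (hk : 0 < k) (hpts : ∀ h ∈ 𝓗, (pts h).card = k)
    (hD : ∀ h ∈ 𝓗, {x ∈ 𝓗 | Meets pts h x}.card ≤ D) (L : Finset P) (hL : ∀ h ∈ R, pts h ⊆ L)
    (f : Finset P → ℂ) (hf1 : ∀ r, ‖f r‖ ≤ 1)
    (hloc : ∀ r ⊆ X, ∀ r' ⊆ X, r ∩ L = r' ∩ L → cluster pts 𝓗 R r' = cluster pts 𝓗 R r →
      (∀ c ∈ cluster pts 𝓗 R r, ∀ h ∈ 𝓗, Meets pts c h → r ∩ pts h = r' ∩ pts h) → f r' = f r)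
    (Q : Finset ι → Prop) [DecidablePred Q]
    (hQ : ∀ r ⊆ X, f r ≠ 0 → ∀ T, IsSkeleton pts 𝓗 R (cluster pts 𝓗 R r) T → Q T) :
    ‖∑ r ∈ X.powerset, prodWeight q X r * f r‖ ≤
      B ^ L.card * ∑ T ∈ reachSets (Linked pts 𝓗) 𝓗 R with Q T,
        (p ^ k * B ^ (D ^ 2 * k)) ^ T.card := by
  have hne : ∀ h ∈ 𝓗, (pts h).Nonempty := fun h hh =>
    Finset.card_pos.1 (by rw [hpts h hh]; exact hk)
  -- The skeleton is chosen as a function of the cluster alone, so that equal clusters have equal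
  -- skeletons.
  let sk : Finset ι → Finset ι := fun C =>
    if h : ∃ T, IsSkeleton pts 𝓗 R C T then h.choose else ∅
  have hsk : ∀ r, IsSkeleton pts 𝓗 R (cluster pts 𝓗 R r) (sk (cluster pts 𝓗 R r)) := by
    intro r
    have := exists_isSkeleton (R := R) hne r
    simp only [sk, dif_pos this]
    exact this.choose_spec
  -- Each cluster element meets a skeleton element, so two meetings away from `T` suffice to see the
  -- cluster and all its neighbours. This is the source of the exponent `D ^ 2 * k` per skeleton
  -- element.
  let A : Finset ι → Finset P := fun T => L ∪ T.biUnion fun t =>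
    {h ∈ 𝓗 | Meets pts t h}.biUnion fun h => {h' ∈ 𝓗 | Meets pts h h'}.biUnion pts
  have hA : ∀ r, ∀ c ∈ cluster pts 𝓗 R r, ∀ h ∈ 𝓗, Meets pts c h →
      pts h ⊆ A (sk (cluster pts 𝓗 R r)) := by
    intro r c hc h hh hch
    obtain ⟨t, ht, htc⟩ := (hsk r).cover c hc
    refine Finset.Subset.trans ?_ Finset.subset_union_right
    intro x hx
    simp only [Finset.mem_biUnion, Finset.mem_filter]
    exact ⟨t, ht, c, ⟨cluster_subset hc, htc⟩, h, ⟨hh, hch⟩, hx⟩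
  have restrict : ∀ {r r' s u : Finset P}, r ∩ s = r' ∩ s → u ⊆ s → r ∩ u = r' ∩ u := by
    intro r r' s u h hu
    rw [← Finset.inter_eq_right.2 hu, ← Finset.inter_assoc, h, Finset.inter_assoc]
  have main := norm_sum_prodWeight_le_sum q hp hp0 hB hB1 (fun r => sk (cluster pts 𝓗 R r)) A
    (fun T => T.biUnion pts) f hf1 ?_ ?_ ?_
    {T ∈ reachSets (Linked pts 𝓗) 𝓗 R | (T : Set ι).PairwiseDisjoint pts ∧ Q T} ?_
  · refine main.trans ?_
    rw [Finset.mul_sum]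
    refine (Finset.sum_le_sum (g := fun T => B ^ L.card * (p ^ k * B ^ (D ^ 2 * k)) ^ T.card)
      ?_).trans (Finset.sum_le_sum_of_subset_of_nonneg ?_ fun _ _ _ => by positivity)
    · intro T hT
      simp only [Finset.mem_filter, reachSets, Finset.mem_powerset] at hT
      obtain ⟨⟨hT𝓗, -⟩, hdis, -⟩ := hT
      have hO : (T.biUnion pts).card = k * T.card := by
        rw [Finset.card_biUnion fun x hx y hy hxy => hdis hx hy hxy,
          Finset.sum_congr rfl fun x hx => hpts x (hT𝓗 hx)]
        simp [mul_comm]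
      have hAc : (A T).card ≤ L.card + D ^ 2 * k * T.card := by
        refine (Finset.card_union_le _ _).trans (Nat.add_le_add_left ?_ _)
        refine (Finset.card_biUnion_le_card_mul _ _ (D * (D * k)) fun t ht => ?_).trans
          (le_of_eq (by ring))
        refine (Finset.card_biUnion_le_card_mul _ _ (D * k) fun h hh => ?_).trans
          (Nat.mul_le_mul_right _ (hD t (hT𝓗 ht)))
        have hh𝓗 := (Finset.mem_filter.1 hh).1
        refine (Finset.card_biUnion_le_card_mul _ _ k fun h' hh' => ?_).trans
          (Nat.mul_le_mul_right _ (hD h hh𝓗))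
        exact (hpts h' (Finset.mem_filter.1 hh').1).le
      calc p ^ (T.biUnion pts).card * B ^ (A T).card
          ≤ p ^ (k * T.card) * B ^ (L.card + D ^ 2 * k * T.card) := by
            rw [hO]
            exact mul_le_mul_of_nonneg_left (pow_le_pow_right₀ hB1 hAc) (by positivity)
        _ = B ^ L.card * (p ^ k * B ^ (D ^ 2 * k)) ^ T.card := by
            rw [mul_pow, ← pow_mul, ← pow_mul, pow_add]; ring
    · intro T
      simp only [Finset.mem_filter]
      exact fun h => ⟨h.1, h.2.2⟩
  · intro r hr x hx
    obtain ⟨t, ht, hxt⟩ := Finset.mem_biUnion.1 hx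
    have htC := (hsk r).subset ht
    have ht𝓗 := cluster_subset htC
    obtain ⟨y, hy⟩ := hne t ht𝓗
    exact hA r t htC t ht𝓗 (meets_iff.2 ⟨y, hy, hy⟩) hxt
  · intro r hr r' hr' heq
    have h1 : ∀ c ∈ cluster pts 𝓗 R r, ∀ h ∈ 𝓗, Meets pts c h → r ∩ pts h = r' ∩ pts h :=
      fun c hc h hh hch => restrict heq (hA r c hc h hh hch)
    have h2 : r ∩ L = r' ∩ L := restrict heq Finset.subset_union_left
    have h3 : cluster pts 𝓗 R r' = cluster pts 𝓗 R r :=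
      cluster_congr (fun h hh => restrict h2 (hL h hh)) h1
    exact ⟨by rw [h3], hloc r hr r' hr' h2 h3 h1⟩
  · intro r hr
    exact Finset.biUnion_subset.2 fun t ht => pts_subset_of_mem_cluster ((hsk r).subset ht)
  · intro r hr hfr
    simp only [Finset.mem_filter, reachSets, Finset.mem_powerset]
    exact ⟨⟨(hsk r).subset.trans cluster_subset, (hsk r).reach⟩, (hsk r).disjoint,
      hQ r hr hfr _ (hsk r)⟩

end Clusters
-- Update times of the scan and space-time hyperedges
section Scan

variable {V : Type*} {n : ℕ} [NeZero n] (ord : Fin n ≃ V)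

theorem scanVertex_eq_iff {t : ℤ} {u : V} :
    scanVertex ord t = u ↔ t % (n : ℤ) = ((ord.symm u : Fin n) : ℕ) := by
  have hn : (0 : ℤ) < n := by exact_mod_cast Nat.pos_of_ne_zero (NeZero.ne n)
  have h0 := Int.emod_nonneg t hn.ne'
  have h1 := Int.emod_lt_of_pos t hn
  have h2 : (t % (n : ℤ)).toNat < n := by omega
  rw [scanVertex, ← Equiv.eq_symm_apply, Fin.ext_iff, Fin.val_ofNat, Nat.mod_eq_of_lt h2]
  omega

/-- The last time at or before `t` at which `u` is updated. -/
def lastUpdate (u : V) (t : ℤ) : ℤ := t - (t - ((ord.symm u : Fin n) : ℕ)) % (n : ℤ)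

theorem lastUpdate_le (u : V) (t : ℤ) : lastUpdate ord u t ≤ t := by
  have hn : (0 : ℤ) < n := by exact_mod_cast Nat.pos_of_ne_zero (NeZero.ne n)
  have := Int.emod_nonneg (t - ((ord.symm u : Fin n) : ℕ)) hn.ne'
  rw [lastUpdate]; omega

theorem lt_lastUpdate (u : V) (t : ℤ) : t - n < lastUpdate ord u t := by
  have hn : (0 : ℤ) < n := by exact_mod_cast Nat.pos_of_ne_zero (NeZero.ne n)
  have := Int.emod_lt_of_pos (t - ((ord.symm u : Fin n) : ℕ)) hn
  rw [lastUpdate]; omega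

theorem scanVertex_lastUpdate (u : V) (t : ℤ) : scanVertex ord (lastUpdate ord u t) = u := by
  rw [scanVertex_eq_iff, lastUpdate]
  have h1 : (((ord.symm u : Fin n) : ℕ) : ℤ) < n := by exact_mod_cast (ord.symm u).2
  conv_rhs => rw [← Int.emod_eq_of_lt (Int.natCast_nonneg _) h1]
  rw [Int.emod_eq_emod_iff_emod_sub_eq_zero]
  apply Int.emod_eq_zero_of_dvd
  have := Int.emod_add_mul_ediv (t - ((ord.symm u : Fin n) : ℕ)) n
  exact ⟨(t - ((ord.symm u : Fin n) : ℕ)) / n, by linarith⟩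

theorem eq_of_scanVertex_eq {x y : ℤ} (h : scanVertex ord x = scanVertex ord y) (h1 : x < y + n)
    (h2 : y < x + n) : x = y := by
  have hx := (scanVertex_eq_iff ord).1 h
  have hy := (scanVertex_eq_iff ord (t := y)).1 rfl
  rw [← hy, Int.emod_eq_emod_iff_emod_sub_eq_zero] at hx
  obtain ⟨c, hc⟩ := Int.dvd_of_emod_eq_zero hx
  have hn : (0 : ℤ) < n := by exact_mod_cast Nat.pos_of_ne_zero (NeZero.ne n)
  have hc1 : c < 1 := by by_contra! h; nlinarith
  have hc2 : -1 < c := by by_contra! h; nlinarith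
  obtain rfl : c = 0 := by omega
  linarith

theorem eq_lastUpdate {u : V} {x t : ℤ} (h : scanVertex ord x = u) (h1 : x ≤ t) (h2 : t - n < x) :
    x = lastUpdate ord u t := by
  have h3 := lastUpdate_le ord u t
  have h4 := lt_lastUpdate ord u t
  exact eq_of_scanVertex_eq ord (h.trans (scanVertex_lastUpdate ord u t).symm) (by omega) (by omega)

theorem lastUpdate_scanVertex (t : ℤ) : lastUpdate ord (scanVertex ord t) t = t := by
  have hn : (0 : ℤ) < n := by exact_mod_cast Nat.pos_of_ne_zero (NeZero.ne n)
  exact (eq_lastUpdate ord rfl le_rfl (by omega)).symm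

theorem lastUpdate_ne {u : V} {t : ℤ} (h : u ≠ scanVertex ord t) : lastUpdate ord u t ≠ t :=
  fun h' => h (by rw [← scanVertex_lastUpdate ord u t, h'])

theorem lastUpdate_sub_one {u : V} {t : ℤ} (h : u ≠ scanVertex ord t) :
    lastUpdate ord u (t - 1) = lastUpdate ord u t := by
  have h1 := lastUpdate_le ord u t
  have h2 := lt_lastUpdate ord u t
  have h3 := lastUpdate_ne ord h
  exact (eq_lastUpdate ord (scanVertex_lastUpdate ord u t) (by omega) (by omega)).symm

/-- The last update times, at or before time `j`, of the vertices of `e`. -/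
def edgeTimes (h : Finset V × ℤ) : Finset ℤ := h.1.image fun u => lastUpdate ord u h.2

omit [NeZero n] in
theorem mem_edgeTimes {h : Finset V × ℤ} {x : ℤ} :
    x ∈ edgeTimes ord h ↔ ∃ u ∈ h.1, lastUpdate ord u h.2 = x := by
  simp [edgeTimes]

theorem scanVertex_mem_of_mem_edgeTimes {h : Finset V × ℤ} {x : ℤ} (hx : x ∈ edgeTimes ord h) :
    scanVertex ord x ∈ h.1 ∧ x ≤ h.2 ∧ h.2 < x + n := by
  obtain ⟨u, hu, rfl⟩ := (mem_edgeTimes ord).1 hx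
  have h1 := lastUpdate_le ord u h.2
  have h2 := lt_lastUpdate ord u h.2
  exact ⟨by rwa [scanVertex_lastUpdate], h1, by omega⟩

theorem card_edgeTimes (h : Finset V × ℤ) : (edgeTimes ord h).card = h.1.card := by
  refine Finset.card_image_of_injective _ fun u u' huu' => ?_
  have huu' : lastUpdate ord u h.2 = lastUpdate ord u' h.2 := huu'
  rw [← scanVertex_lastUpdate ord u h.2, huu', scanVertex_lastUpdate]

theorem Meets.abs_sub_lt {a b : Finset V × ℤ} (h : Meets (edgeTimes ord) a b) :
    a.2 < b.2 + n ∧ b.2 < a.2 + n := by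
  obtain ⟨x, hx, hy⟩ := meets_iff.1 h
  have h1 := (scanVertex_mem_of_mem_edgeTimes ord hx).2
  have h2 := (scanVertex_mem_of_mem_edgeTimes ord hy).2
  omega

variable [DecidableEq V]

/-- The space-time hyperedges inside the set of times `X`, labelled by their last update time. -/
def timeEdges (E : Finset (Finset V)) (X : Finset ℤ) : Finset (Finset V × ℤ) :=
  {h ∈ E ×ˢ X | scanVertex ord h.2 ∈ h.1 ∧ edgeTimes ord h ⊆ X}

theorem mem_timeEdges {E : Finset (Finset V)} {X : Finset ℤ} {h : Finset V × ℤ} :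
    h ∈ timeEdges ord E X ↔ h.1 ∈ E ∧ scanVertex ord h.2 ∈ h.1 ∧ edgeTimes ord h ⊆ X := by
  simp only [timeEdges, Finset.mem_filter, Finset.mem_product]
  constructor
  · tauto
  · rintro ⟨h1, h2, h3⟩
    exact ⟨⟨h1, h3 ((mem_edgeTimes ord).2 ⟨_, h2, lastUpdate_scanVertex ord _⟩)⟩, h2, h3⟩

variable {E : Finset (Finset V)} {X : Finset ℤ} {k Δ : ℕ}

/-- A space-time hyperedge through `x` is determined by its hyperedge, which contains the vertex
updated at `x` (at most `Δ` choices), and by which of its vertices is updated last (at most `k`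
choices). -/
theorem card_timeEdges_mem_le (hE : ∀ e ∈ E, e.card = k)
    (hΔ : ∀ v, {e ∈ E | v ∈ e}.card ≤ Δ) (x : ℤ) :
    {h ∈ timeEdges ord E X | x ∈ edgeTimes ord h}.card ≤ Δ * k := by
  have hinj : Set.InjOn (fun h : Finset V × ℤ => (⟨h.1, scanVertex ord h.2⟩ : Finset V × V))
      ({h ∈ timeEdges ord E X | x ∈ edgeTimes ord h} : Finset (Finset V × ℤ)) := by
    rintro ⟨e, j⟩ h1 ⟨e', j'⟩ h2 heq
    rw [Finset.mem_coe, Finset.mem_filter] at h1 h2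
    simp only [Prod.mk.injEq] at heq
    obtain ⟨rfl, hj⟩ := heq
    have h3 := (scanVertex_mem_of_mem_edgeTimes ord h1.2).2
    have h4 := (scanVertex_mem_of_mem_edgeTimes ord h2.2).2
    simp only at h3 h4
    rw [eq_of_scanVertex_eq ord hj (by omega) (by omega)]
  rw [← Finset.card_image_of_injOn hinj]
  have hsub : {h ∈ timeEdges ord E X | x ∈ edgeTimes ord h}.image
      (fun h : Finset V × ℤ => (⟨h.1, scanVertex ord h.2⟩ : Finset V × V)) ⊆
      {e ∈ E | scanVertex ord x ∈ e}.biUnion fun e => e.image fun u => (e, u) := by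
    intro y hy
    simp only [Finset.mem_image, Finset.mem_filter, mem_timeEdges] at hy
    obtain ⟨h, ⟨⟨h1, h2, -⟩, h3⟩, rfl⟩ := hy
    simp only [Finset.mem_biUnion, Finset.mem_filter, Finset.mem_image]
    exact ⟨h.1, ⟨h1, (scanVertex_mem_of_mem_edgeTimes ord h3).1⟩, _, h2, rfl⟩
  refine (Finset.card_le_card hsub).trans ?_
  refine (Finset.card_biUnion_le_card_mul _ _ k fun e he => ?_).trans
    (Nat.mul_le_mul_right _ (hΔ _))
  exact Finset.card_image_le.trans (hE e (Finset.mem_filter.1 he).1).le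

open Classical in
theorem card_timeEdges_meets_le (hE : ∀ e ∈ E, e.card = k)
    (hΔ : ∀ v, {e ∈ E | v ∈ e}.card ≤ Δ) {h : Finset V × ℤ} (hh : h ∈ timeEdges ord E X) :
    {x ∈ timeEdges ord E X | Meets (edgeTimes ord) h x}.card ≤ Δ * k ^ 2 := by
  have hsub : {x ∈ timeEdges ord E X | Meets (edgeTimes ord) h x} ⊆
      (edgeTimes ord h).biUnion fun x => {h ∈ timeEdges ord E X | x ∈ edgeTimes ord h} := by
    intro y
    simp only [Finset.mem_biUnion, Finset.mem_filter, meets_iff]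
    rintro ⟨h1, x, h2, h3⟩
    exact ⟨x, h2, h1, h3⟩
  refine (Finset.card_le_card hsub).trans ?_
  refine (Finset.card_biUnion_le_card_mul _ _ _ fun x _ =>
    card_timeEdges_mem_le ord hE hΔ x).trans ?_
  rw [card_edgeTimes, hE _ ((mem_timeEdges ord).1 hh).1]
  exact le_of_eq (by ring)

end Scan

/-! ### Trajectories driven by a set of attempt times -/

section Run

variable {V : Type*} [DecidableEq V]

/-- The vertex `v` is blocked if some hyperedge at `v` has all its other vertices occupied. -/
def Blocked (E : Finset (Finset V)) (σ : V → Fin 2) (v : V) : Prop :=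
  ∃ e ∈ E, v ∈ e ∧ ∀ u ∈ e, u ≠ v → σ u = 1

open Classical in
/-- Update `v`: occupy it if `b` holds and it is not blocked, and make it vacant otherwise. -/
noncomputable def siteUpdate (E : Finset (Finset V)) (v : V) (b : Prop) (σ : V → Fin 2) :
    V → Fin 2 :=
  Function.update σ v (if b ∧ ¬ Blocked E σ v then 1 else 0)

variable {n : ℕ} [NeZero n] (ord : Fin n ≃ V) (E : Finset (Finset V)) (s : ℤ)

/-- The trajectory started at time `s` from `τ` which attempts to occupy exactly at the times
in `r`. -/
noncomputable def run (r : Finset ℤ) (τ : V → Fin 2) : ℕ → V → Fin 2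
  | 0 => τ
  | m + 1 => siteUpdate E (scanVertex ord (s + m + 1)) (s + m + 1 ∈ r) (run r τ m)

variable {E s}

theorem run_congr_of_mem_iff {r r' : Finset ℤ} (τ : V → Fin 2) {m : ℕ}
    (h : ∀ x, s < x → x ≤ s + m → (x ∈ r ↔ x ∈ r')) :
    run ord E s r τ m = run ord E s r' τ m := by
  induction m with
  | zero => rfl
  | succ m ih =>
    rw [run, run, ih fun x h1 h2 => h x h1 (by push_cast; omega)]
    have := h (s + m + 1) (by omega) (by push_cast; omega)
    rw [propext this]

theorem run_eq_lastUpdate (r : Finset ℤ) (τ : V → Fin 2) (u : V) (m : ℕ) :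
    run ord E s r τ m u = if s < lastUpdate ord u (s + m) then
      run ord E s r τ (lastUpdate ord u (s + m) - s).toNat u else τ u := by
  induction m with
  | zero =>
    have := lastUpdate_le ord u s
    simp [run, this]
  | succ m ih =>
    have e1 : s + ((m + 1 : ℕ) : ℤ) = s + m + 1 := by push_cast; ring
    by_cases h : u = scanVertex ord (s + m + 1)
    · rw [e1, h, lastUpdate_scanVertex, if_pos (by omega)]
      congr 1
      omega
    · rw [e1, ← lastUpdate_sub_one ord h, show s + (m : ℤ) + 1 - 1 = s + m by ring, ← ih, run,
        siteUpdate, Function.update_of_ne h]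

theorem run_prev {r : Finset ℤ} {τ : V → Fin 2} {u : V} {x : ℤ} (hx : s < x)
    (hu : u ≠ scanVertex ord x) :
    run ord E s r τ (x - 1 - s).toNat u = if s < lastUpdate ord u x then
      run ord E s r τ (lastUpdate ord u x - s).toNat u else τ u := by
  rw [run_eq_lastUpdate, show s + ((x - 1 - s).toNat : ℤ) = x - 1 by omega,
    lastUpdate_sub_one ord hu]

theorem run_at {r : Finset ℤ} {τ : V → Fin 2} {x : ℤ} (hx : s < x) :
    run ord E s r τ (x - s).toNat =
      siteUpdate E (scanVertex ord x) (x ∈ r) (run ord E s r τ (x - 1 - s).toNat) := by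
  have e1 : (x - s).toNat = (x - 1 - s).toNat + 1 := by omega
  have e2 : s + ((x - 1 - s).toNat : ℤ) + 1 = x := by omega
  rw [e1, run, e2]

theorem run_at_eq_zero {r : Finset ℤ} {τ : V → Fin 2} {x : ℤ} (hx : s < x) (hr : x ∉ r) :
    run ord E s r τ (x - s).toNat (scanVertex ord x) = 0 := by
  rw [run_at ord hx, siteUpdate, Function.update_self, if_neg (fun h => hr h.1)]

/-- Two trajectories agree at all times of a set that is closed under looking at the relevant
earlier updates. -/
theorem run_congr_on {r r' : Finset ℤ} {τ τ' : V → Fin 2} (S : Set ℤ)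
    (hr : ∀ x ∈ S, s < x → (x ∈ r ↔ x ∈ r'))
    (hS : ∀ x ∈ S, s < x → x ∈ r →
      run ord E s r τ (x - s).toNat (scanVertex ord x) =
        run ord E s r' τ' (x - s).toNat (scanVertex ord x) ∨
      ∀ e ∈ E, scanVertex ord x ∈ e →
        (∃ u ∈ e, u ≠ scanVertex ord x ∧ run ord E s r τ (x - 1 - s).toNat u = 0 ∧
          run ord E s r' τ' (x - 1 - s).toNat u = 0) ∨
        ∀ u ∈ e, u ≠ scanVertex ord x → lastUpdate ord u x ∈ S ∧ s < lastUpdate ord u x)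
    {x : ℤ} (hx : x ∈ S) (hsx : s < x) :
    run ord E s r τ (x - s).toNat (scanVertex ord x) =
      run ord E s r' τ' (x - s).toNat (scanVertex ord x) := by
  induction hN : (x - s).toNat using Nat.strong_induction_on generalizing x with
  | _ N ih =>
  subst hN
  by_cases hxr : x ∈ r
  swap
  · rw [run_at_eq_zero ord hsx hxr, run_at_eq_zero ord hsx fun h => hxr ((hr x hx hsx).2 h)]
  rcases hS x hx hsx hxr with h | h
  · exact h
  -- Blocking is compared hyperedge by hyperedge: a vertex vacant in both runs prevents it in both,
  -- and otherwise all other vertices carry values set at earlier times of `S`, equal by induction.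
  have hblock : Blocked E (run ord E s r τ (x - 1 - s).toNat) (scanVertex ord x) ↔
      Blocked E (run ord E s r' τ' (x - 1 - s).toNat) (scanVertex ord x) := by
    refine exists_congr fun e => and_congr_right fun he => and_congr_right fun hxe => ?_
    rcases h e he hxe with ⟨u, hu, hux, h1, h2⟩ | h
    · constructor
      · intro h3
        have := (h3 u hu hux).symm.trans h1
        simp at this
      · intro h3
        have := (h3 u hu hux).symm.trans h2
        simp at this
    · refine forall_congr' fun u => forall_congr' fun hu => forall_congr' fun hux => ?_
      obtain ⟨h1, h2⟩ := h u hu hux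
      have h3 := lastUpdate_le ord u x
      have h4 := lastUpdate_ne ord hux
      rw [run_prev ord hsx hux, run_prev ord hsx hux, if_pos h2, if_pos h2]
      have := ih _ (by omega) h1 h2 rfl
      rw [scanVertex_lastUpdate] at this
      rw [this]
  rw [run_at ord hsx, run_at ord hsx, siteUpdate, siteUpdate, Function.update_self,
    Function.update_self, propext hblock, propext (hr x hx hsx)]

/-- The trajectory on the open cluster is determined by the neighbourhood of the cluster, except
for the hyperedges that reach back before the starting time. -/
theorem run_congr_cluster {F : Finset (Finset V)} (hEF : E ⊆ F) {m : ℕ}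
    {R : Finset (Finset V × ℤ)} {r r' : Finset ℤ} {τ τ' : V → Fin 2} (S₀ : Set ℤ)
    (hS₀R : ∀ x ∈ S₀, ∀ h ∈ timeEdges ord F (Finset.Ioc s (s + m)), x ∈ edgeTimes ord h → h ∈ R)
    (hS₀ : ∀ x ∈ S₀, s < x → (x ∈ r ↔ x ∈ r'))
    (hR : ∀ h ∈ R, r ∩ edgeTimes ord h = r' ∩ edgeTimes ord h)
    (hC : ∀ c ∈ cluster (edgeTimes ord) (timeEdges ord F (Finset.Ioc s (s + m))) R r,
      ∀ h ∈ timeEdges ord F (Finset.Ioc s (s + m)), Meets (edgeTimes ord) c h →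
        r ∩ edgeTimes ord h = r' ∩ edgeTimes ord h)
    (hbd : ∀ x, (x ∈ S₀ ∨ ∃ c ∈ cluster (edgeTimes ord) (timeEdges ord F (Finset.Ioc s (s + m))) R r,
        x ∈ edgeTimes ord c) → s < x →
      run ord E s r τ (x - s).toNat (scanVertex ord x) =
        run ord E s r' τ' (x - s).toNat (scanVertex ord x) ∨
      ∀ e ∈ E, scanVertex ord x ∈ e → (∃ y ∈ edgeTimes ord (e, x), y ≤ s) →
        ∃ u ∈ e, u ≠ scanVertex ord x ∧ run ord E s r τ (x - 1 - s).toNat u = 0 ∧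
          run ord E s r' τ' (x - 1 - s).toNat u = 0)
    (hS₀m : ∀ x ∈ S₀, x ≤ s + m)
    {x : ℤ} (hx : x ∈ S₀ ∨
      ∃ c ∈ cluster (edgeTimes ord) (timeEdges ord F (Finset.Ioc s (s + m))) R r,
        x ∈ edgeTimes ord c) (hsx : s < x) :
    run ord E s r τ (x - s).toNat (scanVertex ord x) =
      run ord E s r' τ' (x - s).toNat (scanVertex ord x) := by
  have hmem : ∀ {u : Finset ℤ} {y : ℤ}, r ∩ u = r' ∩ u → y ∈ u → (y ∈ r ↔ y ∈ r') := by
    intro u y h hy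
    have : y ∈ r ∩ u ↔ y ∈ r' ∩ u := by rw [h]
    simpa [hy] using this
  set 𝓗 := timeEdges ord F (Finset.Ioc s (s + m)) with h𝓗
  set C := cluster (edgeTimes ord) 𝓗 R r with hCdef
  have hself : ∀ c ∈ C, ∀ y ∈ edgeTimes ord c, r ∩ edgeTimes ord c = r' ∩ edgeTimes ord c :=
    fun c hc y hy => hC c hc c (cluster_subset hc) (meets_iff.2 ⟨y, hy, hy⟩)
  refine run_congr_on ord {x | x ∈ S₀ ∨ ∃ c ∈ C, x ∈ edgeTimes ord c} ?_ ?_ hx hsx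
  · rintro y (hy | ⟨c, hc, hy⟩) hsy
    · exact hS₀ y hy hsy
    · exact hmem (hself c hc y hy) hy
  · intro y hy hsy hyr
    rcases hbd y hy hsy with h | h
    · exact .inl h
    refine .inr fun e he hye => ?_
    by_cases hout : ∃ z ∈ edgeTimes ord (e, y), z ≤ s
    · exact .inl (h e he hye hout)
    push Not at hout
    have hym : y ≤ s + m := by
      rcases hy with hy | ⟨c, hc, hy⟩
      · exact hS₀m y hy
      · have := ((mem_timeEdges ord).1 (cluster_subset hc)).2.2 hy
        exact (Finset.mem_Ioc.1 this).2
    have hymem : y ∈ edgeTimes ord (e, y) :=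
      (mem_edgeTimes ord).2 ⟨_, hye, lastUpdate_scanVertex ord y⟩
    have hh : (e, y) ∈ 𝓗 := by
      refine (mem_timeEdges ord).2 ⟨hEF he, hye, fun z hz => Finset.mem_Ioc.2 ⟨hout z hz, ?_⟩⟩
      exact (scanVertex_mem_of_mem_edgeTimes ord hz).2.1.trans hym
    have hagree : r ∩ edgeTimes ord (e, y) = r' ∩ edgeTimes ord (e, y) := by
      rcases hy with hy | ⟨c, hc, hy⟩
      · exact hR _ (hS₀R y hy _ hh hymem)
      · exact hC c hc _ hh (meets_iff.2 ⟨y, hy, hymem⟩)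
    -- An open hyperedge joins the cluster, so its times belong to the closed set. A hyperedge that
    -- is not open has a time without attempt, hence a vertex vacant in both runs.
    by_cases hopen : edgeTimes ord (e, y) ⊆ r
    · right
      have hhC : (e, y) ∈ C := by
        rcases hy with hy | ⟨c, hc, hy⟩
        · exact mem_cluster_of_root hh (hS₀R y hy _ hh hymem) hopen
        · exact mem_cluster_of_meets hc (meets_iff.2 ⟨y, hy, hymem⟩) hh hopen
      intro u hu _
      have hu' : lastUpdate ord u y ∈ edgeTimes ord (e, y) := (mem_edgeTimes ord).2 ⟨u, hu, rfl⟩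
      exact ⟨.inr ⟨_, hhC, hu'⟩, hout _ hu'⟩
    · left
      rw [Finset.not_subset] at hopen
      obtain ⟨z, hz, hzr⟩ := hopen
      obtain ⟨u, hu, hz'⟩ := (mem_edgeTimes ord).1 hz
      simp only at hu hz'
      have hzr' : z ∉ r' := fun h => hzr ((hmem hagree hz).2 h)
      have huy : u ≠ scanVertex ord y := by
        rintro rfl
        rw [lastUpdate_scanVertex] at hz'
        exact hzr (hz' ▸ hyr)
      have hsz := hout z hz
      have hzu : scanVertex ord z = u := by rw [← hz', scanVertex_lastUpdate]
      refine ⟨u, hu, huy, ?_, ?_⟩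
      · rw [run_prev ord hsy huy, hz', if_pos hsz, ← hzu, run_at_eq_zero ord hsz hzr]
      · rw [run_prev ord hsy huy, hz', if_pos hsz, ← hzu, run_at_eq_zero ord hsz hzr']

end Run
-- Rarity of full hyperedges and loss of memory
section Estimates

variable {V : Type*} {n : ℕ} [NeZero n] (ord : Fin n ≃ V)

/-- A space-time hyperedge is labelled by a time at which one of its own vertices is updated; `j` is
the latest of the last updates in `e`. -/
theorem exists_timeEdge_eq {e : Finset V} (he : e.Nonempty) (t : ℤ) :
    ∃ j ≤ t, scanVertex ord j ∈ e ∧ ∀ u ∈ e, lastUpdate ord u j = lastUpdate ord u t := by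
  obtain ⟨v, hv, hmax⟩ := Finset.exists_max_image e (fun u => lastUpdate ord u t) he
  refine ⟨lastUpdate ord v t, lastUpdate_le ord v t, by rwa [scanVertex_lastUpdate],
    fun u hu => ?_⟩
  refine (eq_lastUpdate ord (scanVertex_lastUpdate ord u t) (hmax u hu) ?_).symm
  have := lt_lastUpdate ord u t
  have := lastUpdate_le ord v t
  omega

variable [DecidableEq V]

/-- The complex expectation of `g` after `m` updates from time `s` and configuration `τ`, where
each update attempts to occupy its vertex `v` with complex probability `q v`. -/
noncomputable def expect (E : Finset (Finset V)) (q : V → ℂ) (s : ℤ) (m : ℕ)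
    (g : (V → Fin 2) → ℂ) (τ : V → Fin 2) : ℂ :=
  ∑ r ∈ (Finset.Ioc s (s + m)).powerset,
    prodWeight (fun t => q (scanVertex ord t)) (Finset.Ioc s (s + m)) r * g (run ord E s r τ m)

variable {E F : Finset (Finset V)} {k Δ : ℕ} {q : V → ℂ} {p B a : ℝ}

open Classical in
/-- Started from the empty configuration, the complex probability that a hyperedge is fully
occupied is small. -/
theorem norm_expect_edge_le (hEF : E ⊆ F) (hk : 0 < k) (hF : ∀ e ∈ F, e.card = k)
    (hΔ : ∀ v, {e ∈ F | v ∈ e}.card ≤ Δ) (hp : ∀ v, ‖q v‖ ≤ p) (hp0 : 0 ≤ p)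
    (hB : ∀ v, ‖q v‖ + ‖1 - q v‖ ≤ B) (hB1 : 1 ≤ B) (ha : 0 ≤ a)
    (hza : p ^ k * B ^ ((Δ * k ^ 2) ^ 2 * k) * (1 + a) ^ ((Δ * k ^ 2) ^ 2) ≤ a)
    {e : Finset V} (he : e ∈ F) (s : ℤ) {m : ℕ} (hm : n ≤ m) {g : (V → Fin 2) → ℂ}
    (hg1 : ∀ σ, (∀ u ∈ e, σ u = 1) → g σ = 1) (hg0 : ∀ σ, ¬ (∀ u ∈ e, σ u = 1) → g σ = 0) :
    ‖expect ord E q s m g 0‖ ≤ B ^ k * a := by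
  obtain rfl : g = fun σ => if ∀ u ∈ e, σ u = 1 then 1 else 0 := by
    funext σ
    split_ifs with h
    · exact hg1 σ h
    · exact hg0 σ h
  have hene : e.Nonempty := Finset.card_pos.1 (by rw [hF e he]; exact hk)
  obtain ⟨j, hjm, hje, hj⟩ := exists_timeEdge_eq ord hene (s + m)
  set X := Finset.Ioc s (s + (m : ℤ)) with hX
  set 𝓗 := timeEdges ord F X with h𝓗
  have hlt : ∀ u, s < lastUpdate ord u (s + m) := fun u => by
    have := lt_lastUpdate ord u (s + m); omega
  have h₀ : (e, j) ∈ 𝓗 := by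
    refine (mem_timeEdges ord).2 ⟨he, hje, fun x hx => ?_⟩
    obtain ⟨u, hu, rfl⟩ := (mem_edgeTimes ord).1 hx
    simp only at hu ⊢
    rw [hj u hu, hX, Finset.mem_Ioc]
    exact ⟨hlt u, lastUpdate_le ord u _⟩
  set f : Finset ℤ → ℂ := fun r => if ∀ u ∈ e, run ord E s r 0 m u = 1 then 1 else 0 with hf
  have hrun : ∀ (r : Finset ℤ) u, run ord E s r 0 m u =
      run ord E s r 0 (lastUpdate ord u (s + m) - s).toNat u := fun r u => by
    rw [run_eq_lastUpdate ord r 0 u m, if_pos (hlt u)]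
  have hopen : ∀ r, (∀ u ∈ e, run ord E s r 0 m u = 1) → edgeTimes ord (e, j) ⊆ r := by
    intro r hr x hx
    obtain ⟨u, hu, rfl⟩ := (mem_edgeTimes ord).1 hx
    simp only at hu ⊢
    rw [hj u hu]
    by_contra hcon
    have h1 := run_at_eq_zero (τ := 0) (E := E) ord (hlt u) hcon
    rw [scanVertex_lastUpdate, ← hrun, hr u hu] at h1
    simp at h1
  have hone : ∀ r, f r ≠ 0 → ∀ u ∈ e, run ord E s r 0 m u = 1 := by
    intro r hr
    by_contra hcon
    exact hr (if_neg hcon)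
  have main := norm_sum_prodWeight_le_reachSets (pts := edgeTimes ord) (𝓗 := 𝓗) (R := {(e, j)})
    (fun t => q (scanVertex ord t)) (p := p) (B := B) (X := X) (fun x _ => hp _) hp0
    (fun x _ => hB _) hB1 hk
    (fun h hh => by rw [card_edgeTimes, hF _ ((mem_timeEdges ord).1 hh).1])
    (fun h hh => card_timeEdges_meets_le ord hF hΔ hh)
    (edgeTimes ord (e, j)) (fun h hh => by rw [Finset.mem_singleton.1 hh]) f
    (fun r => by simp only [hf]; split_ifs <;> simp) ?_ (fun T => T.Nonempty) ?_
  · rw [card_edgeTimes, hF e he] at main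
    refine main.trans (mul_le_mul_of_nonneg_left ?_ (by positivity))
    have hN : ∀ u ∈ 𝓗, {x ∈ 𝓗 | Linked (edgeTimes ord) 𝓗 u x}.card ≤ (Δ * k ^ 2) ^ 2 :=
      fun u hu => card_linked_le (fun h hh => card_timeEdges_meets_le ord hF hΔ hh) hu
    refine le_trans ?_ ((sum_rootedSets_le (by positivity) ha hza 𝓗 {(e, j)} hN).trans
      (by simp))
    -- A nonempty set reachable from the single root contains that root. Dropping the empty set
    -- replaces the bound `1 + a` by `a`.
    refine Finset.sum_le_sum_of_subset_of_nonneg ?_ fun _ _ _ => by positivity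
    intro T hT
    simp only [reachSets, rootedSets, Finset.mem_filter, Finset.mem_powerset] at hT ⊢
    obtain ⟨⟨h1, h2⟩, x, hx⟩ := hT
    refine ⟨h1, ?_, h2⟩
    have : (e, j) ∈ T := by
      induction h2 x hx with
      | root h3 h4 =>
        rw [Finset.mem_coe, Finset.mem_singleton] at h3
        rwa [← h3]
      | step h3 _ _ ih => exact ih h3.mem
    simpa using this
  · intro r hr r' hr' hL hC1 hC2
    by_cases hop : edgeTimes ord (e, j) ⊆ r
    · have hmemC : (e, j) ∈ cluster (edgeTimes ord) 𝓗 {(e, j)} r :=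
        mem_cluster_of_root h₀ (by simp) hop
      have heq : ∀ u ∈ e, run ord E s r 0 m u = run ord E s r' 0 m u := by
        intro u hu
        have := run_congr_cluster (E := E) ord hEF (τ := 0) (τ' := 0) (r := r) (r' := r')
          (R := {(e, j)}) (s := s) (m := m) ∅ (by simp) (by simp)
          (fun h hh => by rw [Finset.mem_singleton.1 hh]; exact hL) hC2
          -- A hyperedge reaching back to time `s` or earlier has a vertex not yet updated, vacant
          -- in both runs because the start is the empty configuration.
          (fun x _ hsx => .inr fun e' _ _ ⟨y, hy, hys⟩ => by
            obtain ⟨u', hu', rfl⟩ := (mem_edgeTimes ord).1 hy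
            simp only at hu' hys
            have hne : u' ≠ scanVertex ord x := by
              rintro rfl
              rw [lastUpdate_scanVertex] at hys
              omega
            refine ⟨u', hu', hne, ?_, ?_⟩ <;>
            · rw [run_prev ord hsx hne, if_neg (by omega)]; rfl)
          (by simp) (x := lastUpdate ord u (s + m))
          (.inr ⟨_, hmemC, (mem_edgeTimes ord).2 ⟨u, hu, hj u hu⟩⟩) (hlt u)
        rwa [scanVertex_lastUpdate, ← hrun, ← hrun] at this
      simp only [hf]
      congr 1
      refine propext (forall_congr' fun u => forall_congr' fun hu => ?_)
      rw [heq u hu]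
    · have hop' : ¬ edgeTimes ord (e, j) ⊆ r' := fun h => hop ((subset_iff_of_inter_eq hL).2 h)
      simp only [hf]
      rw [if_neg fun h => hop (hopen r h), if_neg fun h => hop' (hopen r' h)]
  · intro r hr hfr T hT
    obtain ⟨t, ht, -⟩ := hT.cover (e, j)
      (mem_cluster_of_root h₀ (by simp) (hopen r (hone r hfr)))
    exact ⟨t, ht⟩

open Classical in
/-- The influence of the initial configuration decays exponentially. -/
theorem norm_expect_sub_le (hEF : E ⊆ F) (hk : 0 < k) (hF : ∀ e ∈ F, e.card = k)
    (hΔ : ∀ v, {e ∈ F | v ∈ e}.card ≤ Δ) (hp : ∀ v, ‖q v‖ ≤ p) (hp0 : 0 ≤ p)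
    (hB : ∀ v, ‖q v‖ + ‖1 - q v‖ ≤ B) (hB1 : 1 ≤ B) (ha : 0 ≤ a)
    (hza : 2 * (p ^ k * B ^ ((Δ * k ^ 2) ^ 2 * k)) * (1 + a) ^ ((Δ * k ^ 2) ^ 2) ≤ a)
    {g : (V → Fin 2) → ℂ} (hg : ∀ σ σ', ‖g σ - g σ'‖ ≤ 1) (τ τ' : V → Fin 2) (s : ℤ) {m : ℕ}
    (hm : 2 * n ≤ m) :
    ‖expect ord E q s m g τ - expect ord E q s m g τ'‖ ≤
      B ^ (2 * n + n * (Δ * k) * k) * ((1 / 2) ^ (m / (2 * n) - 2) *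
        (1 + a) ^ (n * (Δ * k))) := by
  have hn : 0 < n := Nat.pos_of_ne_zero (NeZero.ne n)
  set X := Finset.Ioc s (s + (m : ℤ)) with hX
  set 𝓗 := timeEdges ord F X with h𝓗
  -- The last `n` times contain the last update of every vertex, hence fix the final configuration.
  set S₀ := Finset.Ioc (s + m - n) (s + (m : ℤ)) with hS₀
  set R : Finset (Finset V × ℤ) := S₀.biUnion fun x => {h ∈ 𝓗 | x ∈ edgeTimes ord h} with hR
  -- Hyperedges reaching back before the start matter only at times up to `s + n`. Revealing the
  -- first `n` times fixes the run there, whatever the initial configuration.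
  set L : Finset ℤ := (Finset.Ioc s (s + n) ∪ S₀) ∪ R.biUnion (edgeTimes ord) with hL
  have hRc : R.card ≤ n * (Δ * k) := by
    refine (Finset.card_biUnion_le_card_mul _ _ (Δ * k) fun x _ =>
      card_timeEdges_mem_le ord hF hΔ x).trans (Nat.mul_le_mul_right _ ?_)
    rw [hS₀, Int.card_Ioc]; omega
  have hR𝓗 : ∀ h ∈ R, h ∈ 𝓗 ∧ s + m - n < h.2 := by
    intro h hh
    simp only [hR, Finset.mem_biUnion, Finset.mem_filter] at hh
    obtain ⟨x, hx, h1, h2⟩ := hh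
    have h3 := (scanVertex_mem_of_mem_edgeTimes ord h2).2.1
    exact ⟨h1, (Finset.mem_Ioc.1 hx).1.trans_le h3⟩
  have hLc : L.card ≤ 2 * n + n * (Δ * k) * k := by
    have h1 : (Finset.Ioc s (s + (n : ℤ)) ∪ S₀).card ≤ 2 * n := by
      refine (Finset.card_union_le _ _).trans ?_
      rw [hS₀, Int.card_Ioc, Int.card_Ioc]; omega
    have h2 : (R.biUnion (edgeTimes ord)).card ≤ n * (Δ * k) * k := by
      refine (Finset.card_biUnion_le_card_mul _ _ k fun h hh => ?_).trans
        (Nat.mul_le_mul_right _ hRc)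
      rw [card_edgeTimes, hF _ ((mem_timeEdges ord).1 (hR𝓗 h hh).1).1]
    exact (Finset.card_union_le _ _).trans (Nat.add_le_add h1 h2)
  have hmem : ∀ {u r r' : Finset ℤ} {y : ℤ}, r ∩ u = r' ∩ u → y ∈ u → (y ∈ r ↔ y ∈ r') := by
    intro u r r' y h hy
    have : y ∈ r ∩ u ↔ y ∈ r' ∩ u := by rw [h]
    simpa [hy] using this
  have hS₀R : ∀ x ∈ (S₀ : Set ℤ), ∀ h ∈ 𝓗, x ∈ edgeTimes ord h → h ∈ R := by
    intro x hx h hh hxh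
    simp only [hR, Finset.mem_biUnion, Finset.mem_filter]
    exact ⟨x, hx, hh, hxh⟩
  have hlt : ∀ u, lastUpdate ord u (s + m) ∈ S₀ ∧ s < lastUpdate ord u (s + m) := fun u => by
    have h1 := lt_lastUpdate ord u (s + m)
    have h2 := lastUpdate_le ord u (s + m)
    exact ⟨Finset.mem_Ioc.2 ⟨h1, h2⟩, by omega⟩
  have hfinal : ∀ {r r' : Finset ℤ} {τ τ' : V → Fin 2},
      (∀ x ∈ S₀, s < x → run ord E s r τ (x - s).toNat (scanVertex ord x) =
        run ord E s r' τ' (x - s).toNat (scanVertex ord x)) →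
      run ord E s r τ m = run ord E s r' τ' m := by
    intro r r' τ τ' h
    funext u
    rw [run_eq_lastUpdate ord r τ u m, run_eq_lastUpdate ord r' τ' u m, if_pos (hlt u).2,
      if_pos (hlt u).2]
    have := h _ (hlt u).1 (hlt u).2
    rwa [scanVertex_lastUpdate] at this
  have hlocal : ∀ (τ : V → Fin 2) (r r' : Finset ℤ), r ∩ L = r' ∩ L →
      (∀ c ∈ cluster (edgeTimes ord) 𝓗 R r, ∀ h ∈ 𝓗, Meets (edgeTimes ord) c h →
        r ∩ edgeTimes ord h = r' ∩ edgeTimes ord h) →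
      run ord E s r τ m = run ord E s r' τ m := by
    intro τ r r' hL1 hC
    refine hfinal fun x hx hsx => run_congr_cluster ord hEF (S₀ : Set ℤ) hS₀R
      (fun x hx _ => hmem hL1 ?_) (fun h hh => ?_) hC (fun x _ hsx => ?_) (fun x hx => ?_)
      (.inl hx) hsx
    · exact Finset.mem_union_left _ (Finset.mem_union_right _ hx)
    · ext x
      simp only [Finset.mem_inter]
      refine and_congr_left fun hx => hmem hL1 ?_
      exact Finset.mem_union_right _ (Finset.mem_biUnion.2 ⟨h, hh, hx⟩)
    · by_cases hxn : x ≤ s + n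
      · left
        rw [run_congr_of_mem_iff ord τ fun y h1 h2 => hmem hL1 ?_]
        refine Finset.mem_union_left _ (Finset.mem_union_left _ (Finset.mem_Ioc.2 ⟨h1, ?_⟩))
        omega
      · right
        rintro e _ _ ⟨y, hy, hys⟩
        have := (scanVertex_mem_of_mem_edgeTimes ord hy).2
        simp only at this
        omega
    · exact (Finset.mem_Ioc.1 hx).2
  -- If the cluster stays after time `s + n`, no hyperedge consulted reaches back to the start, so
  -- both runs end in the same configuration.
  have hgood : ∀ r, (∀ c ∈ cluster (edgeTimes ord) 𝓗 R r, ∀ x ∈ edgeTimes ord c, s + n < x) →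
      run ord E s r τ m = run ord E s r τ' m := by
    intro r hr
    refine hfinal fun x hx hsx => run_congr_cluster ord hEF (S₀ : Set ℤ) hS₀R
      (fun x hx _ => Iff.rfl) (fun h hh => rfl) (fun _ _ _ _ _ => rfl) (fun x hx hsx => ?_)
      (fun x hx => (Finset.mem_Ioc.1 hx).2) (.inl hx) hsx
    right
    rintro e _ _ ⟨y, hy, hys⟩
    have h1 := (scanVertex_mem_of_mem_edgeTimes ord hy).2
    simp only at h1
    have h2 : s + n < x := by
      rcases hx with hx | ⟨c, hc, hx⟩
      · have := (Finset.mem_Ioc.1 hx).1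
        omega
      · exact hr c hc x hx
    omega
  have main := norm_sum_prodWeight_le_reachSets (pts := edgeTimes ord) (𝓗 := 𝓗) (R := R)
    (fun t => q (scanVertex ord t)) (p := p) (B := B) (X := X) (fun x _ => hp _) hp0
    (fun x _ => hB _) hB1 hk
    (fun h hh => by rw [card_edgeTimes, hF _ ((mem_timeEdges ord).1 hh).1])
    (fun h hh => card_timeEdges_meets_le ord hF hΔ hh) L
    (fun h hh => Finset.Subset.trans (Finset.subset_biUnion_of_mem (edgeTimes ord) hh)
      Finset.subset_union_right)
    (fun r => g (run ord E s r τ m) - g (run ord E s r τ' m)) (fun r => hg _ _) ?_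
    (fun T => m / (2 * n) - 2 ≤ T.card) ?_
  · have e1 : expect ord E q s m g τ - expect ord E q s m g τ' = ∑ r ∈ X.powerset,
        prodWeight (fun t => q (scanVertex ord t)) X r *
          (g (run ord E s r τ m) - g (run ord E s r τ' m)) := by
      simp only [expect, ← Finset.sum_sub_distrib, mul_sub, hX]
    rw [e1]
    refine main.trans ?_
    refine mul_le_mul (pow_le_pow_right₀ hB1 hLc) ?_
      (Finset.sum_nonneg fun _ _ => by positivity) (by positivity)
    have hN : ∀ u ∈ 𝓗, {x ∈ 𝓗 | Linked (edgeTimes ord) 𝓗 u x}.card ≤ (Δ * k ^ 2) ^ 2 :=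
      fun u hu => card_linked_le (fun h hh => card_timeEdges_meets_le ord hF hΔ hh) hu
    set z := p ^ k * B ^ ((Δ * k ^ 2) ^ 2 * k) with hz
    have hz0 : 0 ≤ z := by positivity
    -- The spare factor 2 in `hza` pays for the decay: `z ^ T.card` is `(1/2) ^ T.card` times `(2 *
    -- z) ^ T.card`, and `T` is large.
    calc ∑ T ∈ reachSets (Linked (edgeTimes ord) 𝓗) 𝓗 R with m / (2 * n) - 2 ≤ T.card, z ^ T.card
        ≤ ∑ T ∈ reachSets (Linked (edgeTimes ord) 𝓗) 𝓗 R with m / (2 * n) - 2 ≤ T.card,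
            (1 / 2) ^ (m / (2 * n) - 2) * (2 * z) ^ T.card := by
          refine Finset.sum_le_sum fun T hT => ?_
          have hT := (Finset.mem_filter.1 hT).2
          have h2 : (1 / 2 : ℝ) ^ T.card ≤ (1 / 2) ^ (m / (2 * n) - 2) :=
            pow_le_pow_of_le_one (by norm_num) (by norm_num) hT
          calc z ^ T.card = (1 / 2) ^ T.card * (2 * z) ^ T.card := by
                rw [← mul_pow]; congr 1; ring
            _ ≤ _ := mul_le_mul_of_nonneg_right h2 (by positivity)
      _ ≤ ∑ T ∈ reachSets (Linked (edgeTimes ord) 𝓗) 𝓗 R,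
            (1 / 2) ^ (m / (2 * n) - 2) * (2 * z) ^ T.card :=
          Finset.sum_le_sum_of_subset_of_nonneg (Finset.filter_subset _ _)
            fun _ _ _ => by positivity
      _ ≤ (1 / 2) ^ (m / (2 * n) - 2) * (1 + a) ^ (n * (Δ * k)) := by
          rw [← Finset.mul_sum]
          refine mul_le_mul_of_nonneg_left ?_ (by positivity)
          refine (sum_reachSets_le (by positivity) ha hza 𝓗 R hN).trans ?_
          exact pow_le_pow_right₀ (by linarith) hRc
  · intro r _ r' _ h1 _ h3
    rw [hlocal τ r r' h1 h3, hlocal τ' r r' h1 h3]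
  · intro r _ hfr T hT
    have hbad : ∃ c ∈ cluster (edgeTimes ord) 𝓗 R r, ∃ x ∈ edgeTimes ord c, x ≤ s + n := by
      by_contra! hcon
      exact hfr (by rw [hgood r hcon, sub_self])
    obtain ⟨c, hc, x, hx, hxn⟩ := hbad
    obtain ⟨t, ht, htc⟩ := hT.cover c hc
    have h1 := (scanVertex_mem_of_mem_edgeTimes ord hx).2.2
    have h2 := htc.abs_sub_lt ord
    have hn' : (0 : ℤ) < 2 * n := by positivity
    have hM : ∀ y ∈ (R : Set (Finset V × ℤ)), (s + m - n) / (2 * (n : ℤ)) ≤ y.2 / (2 * n) :=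
      fun y hy => Int.ediv_le_ediv hn' (hR𝓗 y hy).2.le
    -- Linked labels differ by less than `2 * n`, so their quotients by `2 * n` differ by at most
    -- one. The skeleton therefore hits every level between that of `t`, near the start, and those
    -- of the roots, near the end.
    have hlevel := (hT.reach t ht).exists_level (fun h => h.2 / (2 * (n : ℤ)))
      (fun x _ y _ ⟨c, _, hxc, hcy⟩ => by
        have h3 := hxc.abs_sub_lt ord
        have h4 := hcy.abs_sub_lt ord
        rw [show y.2 / (2 * (n : ℤ)) + 1 = (y.2 + 2 * n) / (2 * n) by
          rw [Int.add_ediv_of_dvd_right (dvd_refl _), Int.ediv_self hn'.ne']]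
        exact Int.ediv_le_ediv hn' (by omega)) hM
    have hsub : Finset.Icc (t.2 / (2 * (n : ℤ))) ((s + m - n) / (2 * n)) ⊆
        T.image fun h => h.2 / (2 * (n : ℤ)) := by
      intro i hi
      rw [Finset.mem_Icc] at hi
      obtain ⟨y, hy, hyi⟩ := hlevel i hi.1 hi.2
      exact Finset.mem_image.2 ⟨y, hy, hyi⟩
    have hcard := (Finset.card_le_card hsub).trans Finset.card_image_le
    rw [Int.card_Icc] at hcard
    have h5 : t.2 / (2 * (n : ℤ)) ≤ (s + 3 * n) / (2 * n) := Int.ediv_le_ediv hn' (by omega)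
    -- The levels run from at most that of `s + 3 * n` to that of `s + m - n`; the missing `4 * n`
    -- times account for the subtracted 2.
    have h6 : (s + 3 * n) / (2 * (n : ℤ)) + ((m / (2 * n) : ℕ) - 2 : ℤ) ≤
        (s + m - n) / (2 * n) := by
      rw [← Int.add_mul_ediv_right _ _ hn'.ne']
      refine Int.ediv_le_ediv hn' ?_
      have : 2 * n * (m / (2 * n)) ≤ m := Nat.mul_div_le m (2 * n)
      have : (2 * n * ((m / (2 * n) : ℕ) : ℤ)) ≤ m := by exact_mod_cast this
      nlinarith
    omega

end Estimates
-- The attempt kernel, its stationarity and its expansion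
section Kernel

variable {V : Type*} [DecidableEq V]

theorem blocked_update_self (E : Finset (Finset V)) (σ : V → Fin 2) (v : V) (c : Fin 2) :
    Blocked E (Function.update σ v c) v ↔ Blocked E σ v := by
  refine exists_congr fun e => and_congr_right fun _ => and_congr_right fun _ =>
    forall_congr' fun u => forall_congr' fun _ => forall_congr' fun hu => ?_
  rw [Function.update_of_ne hu]

theorem siteUpdate_update_self (E : Finset (Finset V)) (σ : V → Fin 2) (v : V) (b : Prop)
    (c : Fin 2) : siteUpdate E v b (Function.update σ v c) = siteUpdate E v b σ := by
  rw [siteUpdate, siteUpdate, Function.update_idem, propext (blocked_update_self E σ v c)]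

variable [Fintype V]

theorem sum_config_eq (v : V) (f : (V → Fin 2) → ℂ) :
    ∑ σ, f σ = ∑ σ with σ v = 0, (f (Function.update σ v 0) + f (Function.update σ v 1)) := by
  rw [← Finset.sum_filter_add_sum_filter_not Finset.univ (fun σ : V → Fin 2 => σ v = 0),
    Finset.sum_add_distrib]
  congr 1
  · refine Finset.sum_congr rfl fun σ hσ => ?_
    rw [← (Finset.mem_filter.1 hσ).2, Function.update_eq_self]
  · symm
    refine Finset.sum_bij' (fun σ _ => Function.update σ v 1) (fun σ _ => Function.update σ v 0)
      ?_ ?_ ?_ ?_ ?_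
    · intro σ _; simp
    · intro σ _; simp
    · intro σ hσ
      rw [Function.update_idem, ← (Finset.mem_filter.1 hσ).2, Function.update_eq_self]
    · intro σ hσ
      have : σ v = 1 := by
        have := (Finset.mem_filter.1 hσ).2
        omega
      rw [Function.update_idem, ← this, Function.update_eq_self]
    · intro σ _; rfl

open Classical in
/-- The weight of the configuration `σ` for the hyperedges `E`. -/
noncomputable def edgeWeight (E : Finset (Finset V)) (lam : V → ℂ) (σ : V → Fin 2) : ℂ :=
  if ∀ e ∈ E, ∃ v ∈ e, σ v = 0 then ∏ v with σ v = 1, lam v else 0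

theorem edgeWeight_update_one (E : Finset (Finset V)) (lam : V → ℂ) (σ : V → Fin 2) (v : V)
    [Decidable (Blocked E σ v)] :
    edgeWeight E lam (Function.update σ v 1) =
      if Blocked E σ v then 0 else lam v * edgeWeight E lam (Function.update σ v 0) := by
  have hone : ∀ {c : Fin 2}, c ≠ 0 ↔ c = 1 := by intro c; omega
  split_ifs with h
  · obtain ⟨e, he, hve, hu⟩ := h
    refine if_neg fun hcon => ?_
    obtain ⟨u, hue, h0⟩ := hcon e he
    by_cases huv : u = v
    · subst huv; simp at h0
    · rw [Function.update_of_ne huv, hu u hue huv] at h0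
      simp at h0
  · have hind : (∀ e ∈ E, ∃ u ∈ e, Function.update σ v 1 u = 0) ↔
        ∀ e ∈ E, ∃ u ∈ e, Function.update σ v 0 u = 0 := by
      refine forall_congr' fun e => forall_congr' fun he => ?_
      constructor
      · rintro ⟨u, hu, h0⟩
        have huv : u ≠ v := by rintro rfl; simp at h0
        rw [Function.update_of_ne huv] at h0
        exact ⟨u, hu, by rwa [Function.update_of_ne huv]⟩
      · rintro ⟨u, hu, h0⟩
        by_cases huv : u = v
        · subst huv
          by_contra! hcon
          refine h ⟨e, he, hu, fun w hw hwu => ?_⟩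
          have := hcon w hw
          rw [Function.update_of_ne hwu] at this
          exact hone.1 this
        · rw [Function.update_of_ne huv] at h0
          exact ⟨u, hu, by rwa [Function.update_of_ne huv]⟩
    have hprod : ∏ u with Function.update σ v 1 u = 1, lam u =
        lam v * ∏ u with Function.update σ v 0 u = 1, lam u := by
      rw [← Finset.prod_insert (by simp)]
      refine Finset.prod_congr ?_ fun _ _ => rfl
      ext u
      by_cases huv : u = v
      · subst huv; simp
      · simp [huv]
    simp only [edgeWeight, hind, hprod]
    split_ifs <;> simp

open Classical in
/-- The transition matrix of an update of `v` that attempts to occupy `v` with complex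
probability `q v`. -/
noncomputable def siteKernel (E : Finset (Finset V)) (q : V → ℂ) (v : V) :
    Matrix (V → Fin 2) (V → Fin 2) ℂ :=
  fun σ ω => (1 - q v) * (if ω = siteUpdate E v False σ then 1 else 0) +
    q v * (if ω = siteUpdate E v True σ then 1 else 0)

theorem sum_siteKernel_mul (E : Finset (Finset V)) (q : V → ℂ) (v : V) (σ : V → Fin 2)
    (g : (V → Fin 2) → ℂ) : ∑ ω, siteKernel E q v σ ω * g ω =
      (1 - q v) * g (siteUpdate E v False σ) + q v * g (siteUpdate E v True σ) := by
  simp [siteKernel, add_mul, Finset.sum_add_distrib]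

-- Pair the configurations differing only at `v`. An unblocked pair has weights w and λw, and (1+λ)w
-- is redistributed in proportions 1/(1+λ) and λ/(1+λ); a blocked pair has weights w and 0, and
-- everything is sent to the vacant one. Working with unnormalized weights avoids assuming a nonzero
-- partition function.
open Classical in
theorem sum_edgeWeight_siteKernel (E : Finset (Finset V)) {lam : V → ℂ} {v : V}
    (hlam : 1 + lam v ≠ 0) (g : (V → Fin 2) → ℂ) :
    ∑ σ, edgeWeight E lam σ * ∑ ω, siteKernel E (fun v => lam v / (1 + lam v)) v σ ω * g ω =
      ∑ σ, edgeWeight E lam σ * g σ := by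
  simp only [sum_siteKernel_mul]
  rw [sum_config_eq v, sum_config_eq v]
  refine Finset.sum_congr rfl fun σ _ => ?_
  simp only [siteUpdate_update_self, edgeWeight_update_one]
  simp only [siteUpdate, false_and, true_and, if_false]
  split_ifs with h
  · ring
  · field_simp
    ring

theorem vecMul_edgeWeight_siteKernel (E : Finset (Finset V)) {lam : V → ℂ} {v : V}
    (hlam : 1 + lam v ≠ 0) (c : ℂ) :
    Matrix.vecMul (fun σ => edgeWeight E lam σ / c)
      (siteKernel E (fun v => lam v / (1 + lam v)) v) = fun σ => edgeWeight E lam σ / c := by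
  classical
  funext ω
  have := sum_edgeWeight_siteKernel E hlam fun σ => if σ = ω then 1 else 0
  simp only [mul_ite, mul_one, mul_zero, Finset.sum_ite_eq', Finset.mem_univ, if_true] at this
  simp only [Matrix.vecMul, dotProduct]
  rw [← this, Finset.sum_div]
  exact Finset.sum_congr rfl fun σ _ => by ring

variable {n : ℕ} [NeZero n] (ord : Fin n ≃ V)

theorem expect_succ (E : Finset (Finset V)) (q : V → ℂ) (s : ℤ) (m : ℕ)
    (g : (V → Fin 2) → ℂ) (τ : V → Fin 2) :
    expect ord E q s (m + 1) g τ = expect ord E q s m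
      (fun σ => ∑ ω, siteKernel E q (scanVertex ord (s + m + 1)) σ ω * g ω) τ := by
  have hIoc : Finset.Ioc s (s + ((m + 1 : ℕ) : ℤ)) =
      insert (s + m + 1) (Finset.Ioc s (s + (m : ℤ))) := by
    ext x; simp only [Finset.mem_Ioc, Finset.mem_insert]; push_cast; omega
  have hnot : s + m + 1 ∉ Finset.Ioc s (s + (m : ℤ)) := by simp
  rw [expect, hIoc, sum_prodWeight_insert _ hnot, expect]
  refine Finset.sum_congr rfl fun r hr => ?_
  have hr' : s + m + 1 ∉ r := fun h => hnot (Finset.mem_powerset.1 hr h)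
  rw [sum_siteKernel_mul, run, run, run_congr_of_mem_iff ord τ (r := insert (s + m + 1) r) (r' := r)]
  · simp [hr']
  · intro x _ hx
    rw [Finset.mem_insert, or_iff_right (by omega)]

/-- The bridge from the matrix evolution to the expansion over attempt times, by peeling off the
last update. -/
theorem sum_evolve_siteKernel (E : Finset (Finset V)) (q : V → ℂ) (s : ℤ) (m : ℕ)
    (ν g : (V → Fin 2) → ℂ) :
    ∑ ω, evolve (fun t => siteKernel E q (scanVertex ord t)) s ν m ω * g ω =
      ∑ τ, ν τ * expect ord E q s m g τ := by
  induction m generalizing g with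
  | zero => simp [evolve, expect, prodWeight, run]
  | succ m ih =>
    simp only [expect_succ, ← ih, evolve, Matrix.vecMul, dotProduct, Finset.sum_mul,
      Finset.mul_sum]
    rw [Finset.sum_comm]
    simp only [mul_assoc]

theorem evolve_eq_of_stationary {Ω : Type*} [Fintype Ω] {P : ℤ → Matrix Ω Ω ℂ} {μ : Ω → ℂ}
    (h : ∀ t, Matrix.vecMul μ (P t) = μ) (s : ℤ) (m : ℕ) : evolve P s μ m = μ := by
  induction m with
  | zero => rfl
  | succ m ih => rw [evolve, ih, h]

/-- Scan matrices are controlled only on rows in the support of the Gibbs measure; this suffices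
because the evolution never leaves it. -/
theorem evolve_congr {Ω : Type*} [Fintype Ω] {P P' : ℤ → Matrix Ω Ω ℂ} {S : Set Ω}
    (h : ∀ t, ∀ σ ∈ S, ∀ τ, P t σ τ = P' t σ τ) (hS : ∀ t, ∀ σ ∈ S, ∀ τ, P t σ τ ≠ 0 → τ ∈ S)
    {ν : Ω → ℂ} (hν : Function.support ν ⊆ S) (s : ℤ) (m : ℕ) :
    evolve P s ν m = evolve P' s ν m ∧ Function.support (evolve P s ν m) ⊆ S := by
  induction m with
  | zero => exact ⟨rfl, hν⟩
  | succ m ih =>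
    refine ⟨?_, ?_⟩
    · rw [evolve, evolve, ← ih.1]
      funext τ
      simp only [Matrix.vecMul, dotProduct]
      refine Finset.sum_congr rfl fun σ _ => ?_
      by_cases hσ : evolve P s ν m σ = 0
      · rw [hσ, zero_mul, zero_mul]
      · rw [h _ σ (ih.2 hσ)]
    · intro τ hτ
      rw [Function.mem_support, evolve, Matrix.vecMul, dotProduct] at hτ
      obtain ⟨σ, -, hσ⟩ := Finset.exists_ne_zero_of_sum_ne_zero hτ
      exact hS _ σ (ih.2 (left_ne_zero_of_mul hσ)) τ (right_ne_zero_of_mul hσ)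

end Kernel

/-! ### Nonvanishing of the partition function -/

section ZeroFree

variable {V : Type*} [DecidableEq V] [Fintype V] {n : ℕ} [NeZero n] (ord : Fin n ≃ V)

theorem sum_edgeWeight_empty (lam : V → ℂ) :
    ∑ σ, edgeWeight ∅ lam σ = ∏ v, (1 + lam v) := by
  have h := Finset.prod_univ_sum (fun _ : V => (Finset.univ : Finset (Fin 2)))
    (fun v c => if c = 1 then lam v else 1)
  simp only [Fin.sum_univ_two, Fintype.piFinset_univ] at h
  simp only [edgeWeight, Finset.notMem_empty, false_imp_iff, implies_true, if_true,
    Finset.prod_filter]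
  rw [← h]
  simp

open Classical in
theorem sum_edgeWeight_insert (E : Finset (Finset V)) (e : Finset V) (lam : V → ℂ) :
    ∑ σ, edgeWeight (insert e E) lam σ = ∑ σ, edgeWeight E lam σ -
      ∑ σ, edgeWeight E lam σ * if ∀ u ∈ e, σ u = 1 then 1 else 0 := by
  rw [← Finset.sum_sub_distrib]
  refine Finset.sum_congr rfl fun σ _ => ?_
  have hone : (∃ u ∈ e, σ u = 0) ↔ ¬ ∀ u ∈ e, σ u = 1 := by
    push Not
    exact exists_congr fun u => and_congr_right fun _ => by omega
  simp only [edgeWeight, Finset.forall_mem_insert, hone]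
  split_ifs <;> simp_all

/-- If the influence of the initial configuration vanishes, and fully occupied hyperedges are
unlikely from the empty configuration, then the partition function does not vanish. -/
theorem sum_edgeWeight_ne_zero {F : Finset (Finset V)} {lam : V → ℂ}
    (hlam : ∀ v, 1 + lam v ≠ 0) {δ : ℕ → ℝ} (hδ : Filter.Tendsto δ Filter.atTop (nhds 0)) {m₀ : ℕ}
    (hmix : ∀ E ⊆ F, ∀ g : (V → Fin 2) → ℂ, (∀ σ σ', ‖g σ - g σ'‖ ≤ 1) → ∀ τ τ', ∀ s : ℤ,
      ∀ m ≥ m₀, ‖expect ord E (fun v => lam v / (1 + lam v)) s m g τ -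
        expect ord E (fun v => lam v / (1 + lam v)) s m g τ'‖ ≤ δ m)
    (hedge : ∀ E ⊆ F, ∀ e ∈ F, ∀ m ≥ m₀, ∀ g : (V → Fin 2) → ℂ,
      (∀ σ, (∀ u ∈ e, σ u = 1) → g σ = 1) → (∀ σ, ¬ (∀ u ∈ e, σ u = 1) → g σ = 0) →
      ‖expect ord E (fun v => lam v / (1 + lam v)) 0 m g 0‖ ≤ 1 / 2)
    (E : Finset (Finset V)) (hE : E ⊆ F) : ∑ σ, edgeWeight E lam σ ≠ 0 := by
  classical
  induction E using Finset.induction_on with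
  | empty =>
    rw [sum_edgeWeight_empty]
    exact Finset.prod_ne_zero_iff.2 fun v _ => hlam v
  | insert e E he ih =>
    rw [Finset.insert_subset_iff] at hE
    have hZ := ih hE.2
    rw [sum_edgeWeight_insert]
    set g : (V → Fin 2) → ℂ := fun σ => if ∀ u ∈ e, σ u = 1 then 1 else 0 with hg
    set Z := ∑ σ, edgeWeight E lam σ
    set μ : (V → Fin 2) → ℂ := fun σ => edgeWeight E lam σ / Z with hμ
    have hμ1 : ∑ σ, μ σ = 1 := by rw [hμ, ← Finset.sum_div, div_self hZ]
    have hg1 : ∀ σ σ', ‖g σ - g σ'‖ ≤ 1 := by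
      intro σ σ'; simp only [hg]; split_ifs <;> simp
    -- The total variation of `μ` has no a priori bound, but it does not depend on `m`, so a long
    -- enough run absorbs it.
    have hlim : Filter.Tendsto (fun m => (∑ τ, ‖μ τ‖) * δ m) Filter.atTop (nhds 0) := by
      simpa using hδ.const_mul (∑ τ, ‖μ τ‖)
    obtain ⟨m, hm, hm₀⟩ := ((hlim.eventually (gt_mem_nhds (show (0 : ℝ) < 1 / 2 by norm_num))).and
      (Filter.eventually_ge_atTop m₀)).exists
    have hstat := sum_evolve_siteKernel ord E (fun v => lam v / (1 + lam v)) 0 m μ g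
    rw [evolve_eq_of_stationary (fun t => vecMul_edgeWeight_siteKernel E (hlam _) Z)] at hstat
    have hsmall : ‖∑ σ, μ σ * g σ‖ < 1 := by
      have hsplit : ∑ τ, μ τ * expect ord E (fun v => lam v / (1 + lam v)) 0 m g τ =
          ∑ τ, μ τ * (expect ord E (fun v => lam v / (1 + lam v)) 0 m g τ -
            expect ord E (fun v => lam v / (1 + lam v)) 0 m g 0) +
          expect ord E (fun v => lam v / (1 + lam v)) 0 m g 0 := by
        simp only [mul_sub, Finset.sum_sub_distrib, ← Finset.sum_mul, hμ1]
        ring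
      rw [hstat, hsplit]
      have h1 : ‖∑ τ, μ τ * (expect ord E (fun v => lam v / (1 + lam v)) 0 m g τ -
            expect ord E (fun v => lam v / (1 + lam v)) 0 m g 0)‖ ≤ (∑ τ, ‖μ τ‖) * δ m := by
        refine (norm_sum_le _ _).trans ?_
        rw [Finset.sum_mul]
        refine Finset.sum_le_sum fun τ _ => ?_
        rw [norm_mul]
        exact mul_le_mul_of_nonneg_left (hmix E hE.2 g hg1 _ _ _ m hm₀) (norm_nonneg _)
      have h2 := hedge E hE.2 e hE.1 m hm₀ g (fun σ h => if_pos h) (fun σ h => if_neg h)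
      linarith [norm_add_le (∑ τ, μ τ * (expect ord E (fun v => lam v / (1 + lam v)) 0 m g τ -
            expect ord E (fun v => lam v / (1 + lam v)) 0 m g 0))
            (expect ord E (fun v => lam v / (1 + lam v)) 0 m g 0)]
    intro h0
    -- A vanishing new partition function would mean that `μ` gives mass exactly 1 to `e` being
    -- full.
    have : ∑ σ, μ σ * g σ = 1 := by
      have h1 : ∑ σ, μ σ * g σ = (∑ σ, edgeWeight E lam σ * g σ) / Z := by
        rw [Finset.sum_div]
        exact Finset.sum_congr rfl fun σ _ => by rw [hμ]; ring
      rw [h1, ← sub_eq_zero.1 h0, div_self hZ]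
    rw [this, norm_one] at hsmall
    exact lt_irrefl _ hsmall

end ZeroFree

/-! ### Choice of the expansion constants -/

section Numerics

/-- With κ the right-hand side of the hypothesis and N = (Δk²)², take p = κ^(2/k), so that p^k = κ²
= 1/(8e²N), and a = 1/N, so that (1+a)^N ≤ e. The condition on ε gives B^(Nk) ≤ e, and the smallness
condition reduces to 1/(4N) ≤ 1/N. -/
theorem exists_expansion_constants {k Δ : ℕ} (hk : 2 ≤ k) (hΔ : 3 ≤ Δ) {ε : ℝ} (hε : 0 < ε)
    (hε' : ε < 1 / (9 * (k : ℝ) ^ 5 * (Δ : ℝ) ^ 2)) {lc : ℝ}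
    (hlc : ∀ x : ℝ, 0 ≤ x → x < lc → ((x + ε) / (1 + x - ε)) ^ ((k : ℝ) / 2)
        < 1 / (2 * Real.sqrt 2 * Real.exp 1 * (Δ : ℝ) * (k : ℝ) ^ 2)) :
    ∃ p B a : ℝ, 0 ≤ p ∧ 1 ≤ B ∧ 0 ≤ a ∧
      2 * (p ^ k * B ^ ((Δ * k ^ 2) ^ 2 * k)) * (1 + a) ^ ((Δ * k ^ 2) ^ 2) ≤ a ∧
      B ^ k * a ≤ 1 / 2 ∧
      ∀ z ∈ lyRegion ε lc, 1 + z ≠ 0 ∧ ‖z / (1 + z)‖ ≤ p ∧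
        ‖z / (1 + z)‖ + ‖1 - z / (1 + z)‖ ≤ B := by
  have hkR : (2 : ℝ) ≤ k := by exact_mod_cast hk
  have hΔR : (3 : ℝ) ≤ Δ := by exact_mod_cast hΔ
  set κ : ℝ := 1 / (2 * Real.sqrt 2 * Real.exp 1 * (Δ : ℝ) * (k : ℝ) ^ 2) with hκ
  have hκ0 : 0 < κ := by positivity
  set N : ℕ := (Δ * k ^ 2) ^ 2 with hN
  have hN144 : 144 ≤ N := by
    have : 3 * 2 ^ 2 ≤ Δ * k ^ 2 := Nat.mul_le_mul hΔ (Nat.pow_le_pow_left hk 2)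
    calc 144 = (3 * 2 ^ 2) ^ 2 := by norm_num
      _ ≤ N := Nat.pow_le_pow_left this 2
  have hNR : (144 : ℝ) ≤ N := by exact_mod_cast hN144
  have hN0 : (0 : ℝ) < N := by linarith
  have hNe : (N : ℝ) = (Δ : ℝ) ^ 2 * (k : ℝ) ^ 4 := by rw [hN]; push_cast; ring
  have hεN : ε * (N * k) < 1 / 9 := by
    rw [lt_div_iff₀ (by positivity)] at hε'
    rw [hNe]
    nlinarith
  have hε2 : ε < 1 / 2 := by
    have : ε * 1 ≤ ε * (N * k) := mul_le_mul_of_nonneg_left (by nlinarith) hε.le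
    linarith
  -- This is the bound 1 + 2ε/(1+x-ε) for |q| + |1-q| at its worst point x = 0.
  set B : ℝ := 1 + 2 * ε / (1 - ε) with hBdef
  have hB1 : 1 ≤ B := by
    have : 0 ≤ 2 * ε / (1 - ε) := div_nonneg (by linarith) (by linarith)
    linarith
  have hexp : Real.exp 1 < 2.7182818286 := Real.exp_one_lt_d9
  have hBN : B ^ (N * k) ≤ Real.exp 1 := by
    have h1 : B ≤ Real.exp (2 * ε / (1 - ε)) := by
      rw [hBdef, add_comm]; exact Real.add_one_le_exp _
    calc B ^ (N * k) ≤ Real.exp (2 * ε / (1 - ε)) ^ (N * k) :=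
          pow_le_pow_left₀ (by linarith) h1 _
      _ = Real.exp ((N * k : ℕ) * (2 * ε / (1 - ε))) := (Real.exp_nat_mul _ _).symm
      _ ≤ Real.exp 1 := by
          refine Real.exp_le_exp.2 ?_
          rw [← mul_div_assoc, div_le_one (by linarith)]
          push_cast
          nlinarith
  have hpk : (κ ^ ((2 : ℝ) / k)) ^ k = κ ^ 2 := by
    rw [← Real.rpow_natCast, ← Real.rpow_mul hκ0.le, div_mul_cancel₀ _ (by linarith)]
    norm_num
  have hκ2 : κ ^ 2 = 1 / (8 * Real.exp 1 ^ 2 * N) := by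
    have h2 : Real.sqrt 2 ^ 2 = 2 := Real.sq_sqrt (by norm_num)
    rw [hκ, hNe, div_pow, one_pow]
    congr 1
    calc _ = 4 * Real.sqrt 2 ^ 2 * Real.exp 1 ^ 2 * ((Δ : ℝ) ^ 2 * (k : ℝ) ^ 4) := by ring
      _ = _ := by rw [h2]; ring
  refine ⟨κ ^ ((2 : ℝ) / k), B, 1 / N, by positivity, hB1, by positivity, ?_, ?_, ?_⟩
  · have h1 : (1 + 1 / (N : ℝ)) ^ N ≤ Real.exp 1 := by
      calc (1 + 1 / (N : ℝ)) ^ N ≤ Real.exp (1 / N) ^ N :=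
            pow_le_pow_left₀ (by positivity) (by rw [add_comm]; exact Real.add_one_le_exp _) _
        _ = Real.exp 1 := by rw [← Real.exp_nat_mul, mul_one_div_cancel hN0.ne']
    rw [hpk, hκ2]
    calc 2 * (1 / (8 * Real.exp 1 ^ 2 * N) * B ^ (N * k)) * (1 + 1 / (N : ℝ)) ^ N
        ≤ 2 * (1 / (8 * Real.exp 1 ^ 2 * N) * Real.exp 1) * Real.exp 1 := by gcongr
      _ = 1 / 4 * (1 / (N : ℝ)) := by field_simp; norm_num
      _ ≤ 1 / (N : ℝ) := by
          have : 0 ≤ 1 / (N : ℝ) := by positivity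
          linarith
  · have h1 : B ^ k ≤ B ^ (N * k) :=
      pow_le_pow_right₀ hB1 (Nat.le_mul_of_pos_left _ (by omega))
    calc B ^ k * (1 / N) ≤ 3 * (1 / 144) := by
          refine mul_le_mul (by linarith) ?_ (by positivity) (by norm_num)
          exact one_div_le_one_div_of_le (by norm_num) hNR
      _ ≤ 1 / 2 := by norm_num
  · rintro z ⟨x, hx0, hxlc, hxz⟩
    have hpos : 0 < 1 + x - ε := by linarith
    have hnz : ‖z‖ ≤ x + ε := by
      calc ‖z‖ = ‖(z - x) + x‖ := by ring_nf
        _ ≤ ‖z - x‖ + ‖(x : ℂ)‖ := norm_add_le _ _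
        _ ≤ x + ε := by rw [Complex.norm_of_nonneg hx0]; linarith
    have hn1 : 1 + x - ε ≤ ‖1 + z‖ := by
      have h1 : ‖((1 + x : ℝ) : ℂ)‖ = 1 + x := Complex.norm_of_nonneg (by linarith)
      have h2 : ((1 + x : ℝ) : ℂ) = (1 + z) - (z - x) := by push_cast; ring
      have h3 := norm_sub_le (1 + z) (z - x)
      rw [← h2, h1] at h3
      linarith
    have hne : 1 + z ≠ 0 := by
      intro h; rw [h, norm_zero] at hn1; linarith
    have hq : ‖z / (1 + z)‖ ≤ (x + ε) / (1 + x - ε) := by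
      rw [norm_div]
      exact div_le_div₀ (by linarith) hnz hpos hn1
    refine ⟨hne, hq.trans ?_, ?_⟩
    · have hy0 : 0 ≤ (x + ε) / (1 + x - ε) := div_nonneg (by linarith) hpos.le
      have h1 := Real.rpow_le_rpow (Real.rpow_nonneg hy0 _) (hlc x hx0 hxlc).le
        (show (0 : ℝ) ≤ 2 / k by positivity)
      rw [← Real.rpow_mul hy0] at h1
      have h2 : (k : ℝ) / 2 * (2 / k) = 1 := by field_simp
      rwa [h2, Real.rpow_one] at h1
    · have h1 : 1 - z / (1 + z) = 1 / (1 + z) := by field_simp; ring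
      have h2 : ‖1 - z / (1 + z)‖ ≤ 1 / (1 + x - ε) := by
        rw [h1, norm_div, norm_one]
        exact one_div_le_one_div_of_le hpos hn1
      calc ‖z / (1 + z)‖ + ‖1 - z / (1 + z)‖ ≤ (x + ε) / (1 + x - ε) + 1 / (1 + x - ε) :=
            add_le_add hq h2
        _ = 1 + 2 * ε / (1 + x - ε) := by field_simp; ring
        _ ≤ B := by
            rw [hBdef]
            have : 2 * ε / (1 + x - ε) ≤ 2 * ε / (1 - ε) :=
              div_le_div_of_nonneg_left (by linarith) (by linarith) (by linarith)
            linarith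

end Numerics
-- The Gibbs measure and the scan matrices on its support
section Gibbs

variable {V : Type*} [Fintype V] [DecidableEq V]

theorem eventMeasure_eq_inter_agreeOff (μ : (V → Fin 2) → ℂ) (σ : V → Fin 2) (v : V) (c : Fin 2) :
    eventMeasure μ ({ω | ω v = c} ∩ agreeOff σ v) = μ (Function.update σ v c) := by
  classical
  have : ∀ ω, ω ∈ {ω : V → Fin 2 | ω v = c} ∩ agreeOff σ v ↔ ω = Function.update σ v c := by
    intro ω
    rw [Function.eq_update_iff]
    exact Iff.rfl
  simp [eventMeasure, this]

theorem eventMeasure_agreeOff (μ : (V → Fin 2) → ℂ) (σ : V → Fin 2) (v : V) :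
    eventMeasure μ (agreeOff σ v) =
      μ (Function.update σ v 0) + μ (Function.update σ v 1) := by
  classical
  rw [← eventMeasure_eq_inter_agreeOff μ σ v 0, ← eventMeasure_eq_inter_agreeOff μ σ v 1,
    eventMeasure, eventMeasure, eventMeasure, ← Finset.sum_add_distrib]
  refine Finset.sum_congr rfl fun ω _ => ?_
  simp only [Set.mem_inter_iff, Set.mem_ofPred_eq]
  have : ω v = 0 ∨ ω v = 1 := by omega
  rcases this with h | h <;> simp [h]

open Classical in
/-- The hyperedges of a hypergraph on a finite type, as finite sets. -/
noncomputable def edgeFinset (H : Hypergraph V) : Finset (Finset V) :=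
  {e | (e : Set V) ∈ H.edgeSet}

omit [DecidableEq V] in
theorem mem_edgeFinset {H : Hypergraph V} {e : Finset V} :
    e ∈ edgeFinset H ↔ (e : Set V) ∈ H.edgeSet := by
  simp [edgeFinset]

theorem indepWeight_eq_edgeWeight (H : Hypergraph V) (lam : V → ℂ) (σ : V → Fin 2) :
    indepWeight H lam σ = edgeWeight (edgeFinset H) lam σ := by
  classical
  have : σ ∈ indepSets H ↔ ∀ e ∈ edgeFinset H, ∃ v ∈ e, σ v = 0 := by
    constructor
    · intro h e he
      simpa using h e (mem_edgeFinset.1 he)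
    · intro h e he
      simpa using h e.toFinset (mem_edgeFinset.2 (by simpa using he))
  simp only [indepWeight, edgeWeight, this]

theorem gibbs_eq (H : Hypergraph V) (lam : V → ℂ) :
    gibbs H lam = fun σ => edgeWeight (edgeFinset H) lam σ / indepPoly H lam := by
  funext σ
  rw [gibbs, indepWeight_eq_edgeWeight]

omit [DecidableEq V] in
theorem card_of_mem_edgeFinset {H : Hypergraph V} {k : ℕ} (h : IsUniform H k) :
    ∀ e ∈ edgeFinset H, e.card = k := by
  intro e he
  rw [← h _ (mem_edgeFinset.1 he), Set.ncard_coe_finset]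

theorem card_edgeFinset_filter_le {H : Hypergraph V} {Δ : ℕ} (hV : H.vertexSet = Set.univ)
    (h : MaxDegreeLE H Δ) (v : V) : {e ∈ edgeFinset H | v ∈ e}.card ≤ Δ := by
  refine le_trans ?_ (h v (by rw [hV]; trivial))
  rw [← Set.ncard_coe_finset]
  refine Set.ncard_le_ncard_of_injOn (fun e : Finset V => (e : Set V)) ?_
    Finset.coe_injective.injOn (Set.toFinite _)
  intro e he
  rw [Finset.mem_coe, Finset.mem_filter, mem_edgeFinset] at he
  exact ⟨he.1, by simpa using he.2⟩

variable {H : Hypergraph V} {lam : V → ℂ}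

theorem gibbs_update_one (σ : V → Fin 2) (v : V) [Decidable (Blocked (edgeFinset H) σ v)] :
    gibbs H lam (Function.update σ v 1) = if Blocked (edgeFinset H) σ v then 0
      else lam v * gibbs H lam (Function.update σ v 0) := by
  simp only [gibbs_eq, edgeWeight_update_one]
  split_ifs <;> ring

/-- Vacating a vertex preserves independence and at most removes a factor `lam v` from the weight.
-/
theorem gibbs_update_zero_ne {σ : V → Fin 2} (hσ : gibbs H lam σ ≠ 0) (v : V) :
    gibbs H lam (Function.update σ v 0) ≠ 0 := by
  classical
  have : σ v = 0 ∨ σ v = 1 := by omega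
  rcases this with h | h
  · rwa [← h, Function.update_eq_self]
  · rw [← Function.update_eq_self v σ, h, gibbs_update_one] at hσ
    split_ifs at hσ
    · exact absurd rfl hσ
    · exact right_ne_zero_of_mul hσ

theorem eventMeasure_gibbs_agreeOff_ne {σ : V → Fin 2} (hσ : gibbs H lam σ ≠ 0) {v : V}
    (hv : 1 + lam v ≠ 0) : eventMeasure (gibbs H lam) (agreeOff σ v) ≠ 0 := by
  classical
  have h0 := gibbs_update_zero_ne hσ v
  rw [eventMeasure_agreeOff, gibbs_update_one]
  split_ifs
  · rwa [add_zero]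
  · rw [← one_add_mul]
    exact mul_ne_zero hv h0

theorem siteKernel_mem_support {σ τ : V → Fin 2} (hσ : gibbs H lam σ ≠ 0) {v : V}
    (h : siteKernel (edgeFinset H) (fun v => lam v / (1 + lam v)) v σ τ ≠ 0) :
    gibbs H lam τ ≠ 0 := by
  classical
  have h0 := gibbs_update_zero_ne hσ v
  by_cases h1 : τ = Function.update σ v 0
  · rwa [h1]
  -- If `lam v = 0`, attempts have weight 0 and only the vacated configuration is reachable.
  have hlam : lam v ≠ 0 := by
    intro hl
    apply h
    simp [siteKernel, siteUpdate, hl, h1]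
  by_cases hb : Blocked (edgeFinset H) σ v
  · exact absurd (by simp [siteKernel, siteUpdate, h1, hb]) h
  · by_cases h2 : τ = Function.update σ v 1
    · rw [h2, gibbs_update_one, if_neg hb]
      exact mul_ne_zero hlam h0
    · exact absurd (by simp [siteKernel, siteUpdate, h1, h2, hb]) h

variable {n : ℕ} [NeZero n] (ord : Fin n ≃ V)

/-- Given the rest, v is vacant with mass 1 if blocked, and otherwise has marginals 1/(1+λ) and
λ/(1+λ). Being in the support ensures that the common factor, the mass of the vacated configuration,
cancels. -/
theorem scanMatrix_eq_siteKernel {σ : V → Fin 2} (hσ : gibbs H lam σ ≠ 0)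
    (hlam : ∀ v, 1 + lam v ≠ 0) (t : ℤ) (τ : V → Fin 2) :
    scanMatrix ord (gibbs H lam) t σ τ =
      siteKernel (edgeFinset H) (fun v => lam v / (1 + lam v)) (scanVertex ord t) σ τ := by
  classical
  set v := scanVertex ord t
  have h0 := gibbs_update_zero_ne hσ v
  have hv := hlam v
  have hupd : ∀ c, Function.update σ v c = τ ↔ c = τ v ∧ ∀ u, u ≠ v → σ u = τ u := by
    intro c
    rw [Function.update_eq_iff]
  by_cases h : ∀ u, u ≠ v → σ u = τ u
  swap
  · have hne : ∀ c, τ ≠ Function.update σ v c := fun c hc => h ((hupd c).1 hc.symm).2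
    rw [scanMatrix, if_neg h, siteKernel, siteUpdate, siteUpdate, if_neg (hne _),
      if_neg (hne _)]
    ring
  have hsite : scanMatrix ord (gibbs H lam) t σ τ = siteMarginal (gibbs H lam) σ v (τ v) :=
    if_pos h
  have heq : ∀ c, (τ = Function.update σ v c) = (τ v = c) := fun c =>
    propext ⟨fun hc => ((hupd c).1 hc.symm).1.symm, fun hc => ((hupd c).2 ⟨hc.symm, h⟩).symm⟩
  rw [hsite, siteMarginal, condMeasure, eventMeasure_eq_inter_agreeOff, eventMeasure_agreeOff,
    gibbs_update_one]
  simp only [siteKernel, siteUpdate, heq, false_and, true_and, if_false]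
  have hτ : τ v = 0 ∨ τ v = 1 := by omega
  by_cases hb : Blocked (edgeFinset H) σ v
  · rcases hτ with hc | hc
    · simp [hb, hc, h0]
    · simp [hb, hc, gibbs_update_one]
  · have hden : gibbs H lam (Function.update σ v 0) + lam v * gibbs H lam (Function.update σ v 0) =
        (1 + lam v) * gibbs H lam (Function.update σ v 0) := by ring
    rcases hτ with hc | hc
    · simp only [hb, hc, if_false, not_false_iff, if_true, hden]
      rw [if_neg (by decide)]
      field_simp
      ring
    · simp only [hb, hc, if_false, not_false_iff, if_true, hden, gibbs_update_one]
      rw [if_neg (by decide)]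
      field_simp
      ring

theorem vecMul_gibbs_scanMatrix (hlam : ∀ v, 1 + lam v ≠ 0) (t : ℤ) :
    Matrix.vecMul (gibbs H lam) (scanMatrix ord (gibbs H lam) t) = gibbs H lam := by
  have h := vecMul_edgeWeight_siteKernel (edgeFinset H) (hlam (scanVertex ord t))
    (indepPoly H lam)
  rw [← gibbs_eq] at h
  conv_rhs => rw [← h]
  funext τ
  simp only [Matrix.vecMul, dotProduct]
  refine Finset.sum_congr rfl fun σ _ => ?_
  by_cases hσ : gibbs H lam σ = 0
  · rw [hσ, zero_mul, zero_mul]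
  · rw [scanMatrix_eq_siteKernel ord hσ hlam]

/-- Two normalized measures on the support of the Gibbs measure approach each other under the scan
at the rate at which the influence of the initial configuration decays. -/
theorem norm_evolve_scanMatrix_sub_le (hlam : ∀ v, 1 + lam v ≠ 0) {m₀ : ℕ} {δ : ℕ → ℝ}
    (hmix : ∀ g : (V → Fin 2) → ℂ, (∀ σ σ', ‖g σ - g σ'‖ ≤ 1) → ∀ τ τ', ∀ s : ℤ, ∀ m ≥ m₀,
      ‖expect ord (edgeFinset H) (fun v => lam v / (1 + lam v)) s m g τ -
        expect ord (edgeFinset H) (fun v => lam v / (1 + lam v)) s m g τ'‖ ≤ δ m)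
    {ν ν' : (V → Fin 2) → ℂ} (hν : IsNormalized ν) (hν' : IsNormalized ν')
    (hνs : Function.support ν ⊆ Function.support (gibbs H lam))
    (hνs' : Function.support ν' ⊆ Function.support (gibbs H lam)) (s : ℤ) {m : ℕ} (hm : m₀ ≤ m)
    (ω : V → Fin 2) :
    ‖evolve (scanMatrix ord (gibbs H lam)) s ν m ω -
      evolve (scanMatrix ord (gibbs H lam)) s ν' m ω‖ ≤ (∑ τ, ‖ν τ - ν' τ‖) * δ m := by
  classical
  set q : V → ℂ := fun v => lam v / (1 + lam v) with hq
  set g : (V → Fin 2) → ℂ := fun σ => if σ = ω then 1 else 0 with hg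
  have hg1 : ∀ σ σ', ‖g σ - g σ'‖ ≤ 1 := by
    intro σ σ'; simp only [hg]; split_ifs <;> simp
  have hev : ∀ ν : (V → Fin 2) → ℂ, Function.support ν ⊆ Function.support (gibbs H lam) →
      evolve (scanMatrix ord (gibbs H lam)) s ν m ω =
        ∑ τ, ν τ * expect ord (edgeFinset H) q s m g τ := by
    intro ν hν
    rw [← sum_evolve_siteKernel, ← (evolve_congr (S := Function.support (gibbs H lam))
      (fun t σ hσ τ => scanMatrix_eq_siteKernel ord hσ hlam t τ) (fun t σ hσ τ h => ?_) hν s m).1]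
    · simp [hg]
    · rw [scanMatrix_eq_siteKernel ord hσ hlam] at h
      exact siteKernel_mem_support hσ h
  -- Equal total masses allow subtracting the constant expectation from the empty configuration,
  -- leaving only differences covered by `hmix`.
  have hsum : ∑ τ, (ν τ - ν' τ) = 0 := by
    rw [Finset.sum_sub_distrib, hν, hν', sub_self]
  have hdiff : evolve (scanMatrix ord (gibbs H lam)) s ν m ω -
      evolve (scanMatrix ord (gibbs H lam)) s ν' m ω =
      ∑ τ, (ν τ - ν' τ) * (expect ord (edgeFinset H) q s m g τ -
        expect ord (edgeFinset H) q s m g 0) := by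
    simp_rw [mul_sub]
    rw [Finset.sum_sub_distrib, ← Finset.sum_mul, hsum, zero_mul, sub_zero, hev ν hνs,
      hev ν' hνs', ← Finset.sum_sub_distrib]
    exact Finset.sum_congr rfl fun τ _ => (sub_mul _ _ _).symm
  rw [hdiff, Finset.sum_mul]
  refine (norm_sum_le _ _).trans (Finset.sum_le_sum fun τ _ => ?_)
  rw [norm_mul]
  exact mul_le_mul_of_nonneg_left (hmix g hg1 _ _ _ m hm) (norm_nonneg _)

end Gibbs

end ComplexGlauber

/-! ### Assembly of the main theorem -/

open ComplexGlauber in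
theorem mainTheorem3
    (k Δ : ℕ) (hk : 2 ≤ k) (hΔ : 3 ≤ Δ)
    (ε : ℝ) (hε : 0 < ε) (hε' : ε < 1 / (9 * (k : ℝ) ^ 5 * (Δ : ℝ) ^ 2))
    (lc : ℝ)
    (hlc : ∀ x : ℝ, 0 ≤ x → x < lc →
      ((x + ε) / (1 + x - ε)) ^ ((k : ℝ) / 2)
        < 1 / (2 * Real.sqrt 2 * Real.exp 1 * (Δ : ℝ) * (k : ℝ) ^ 2))
    {V : Type*} [Fintype V] [DecidableEq V]
    (H : Hypergraph V) (hV : H.vertexSet = Set.univ)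
    (hunif : ComplexGlauber.IsUniform H k) (hdeg : ComplexGlauber.MaxDegreeLE H Δ)
    {n : ℕ} [NeZero n] (ord : Fin n ≃ V)
    (lam : V → ℂ) (hlam : ∀ v, lam v ∈ ComplexGlauber.lyRegion ε lc) :
    -- the target measure is well defined and normalized
    ComplexGlauber.indepPoly H lam ≠ 0 ∧
    ComplexGlauber.IsNormalized (ComplexGlauber.gibbs H lam) ∧
    -- the dynamics is well defined on the support of the target measure
    (∀ σ ∈ Function.support (ComplexGlauber.gibbs H lam), ∀ v : V,
      ComplexGlauber.eventMeasure (ComplexGlauber.gibbs H lam)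
        (ComplexGlauber.agreeOff σ v) ≠ 0) ∧
    -- the transition matrices are complex transition matrices on that support
    (∀ t : ℤ, ∀ σ ∈ Function.support (ComplexGlauber.gibbs H lam),
      ∑ τ, ComplexGlauber.scanMatrix ord (ComplexGlauber.gibbs H lam) t σ τ = 1 ∧
      ∀ τ, ComplexGlauber.scanMatrix ord (ComplexGlauber.gibbs H lam) t σ τ ≠ 0 →
        τ ∈ Function.support (ComplexGlauber.gibbs H lam)) ∧
    -- the target measure is stationary
    (∀ t : ℤ, Matrix.vecMul (ComplexGlauber.gibbs H lam)
      (ComplexGlauber.scanMatrix ord (ComplexGlauber.gibbs H lam) t)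
        = ComplexGlauber.gibbs H lam) ∧
    -- started at time `0` from any state in the support, the measure at time `T` converges to it
    (∀ τ ∈ Function.support (ComplexGlauber.gibbs H lam),
      Filter.Tendsto
        (fun T : ℕ => ComplexGlauber.evolve
          (ComplexGlauber.scanMatrix ord (ComplexGlauber.gibbs H lam)) 0
          (ComplexGlauber.pointMass τ) T)
        Filter.atTop (nhds (ComplexGlauber.gibbs H lam))) ∧
    -- started at time `-T` from any state in the support, the measure at time `0` converges to it
    (∀ τ ∈ Function.support (ComplexGlauber.gibbs H lam),
      Filter.Tendsto
        (fun T : ℕ => ComplexGlauber.evolve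
          (ComplexGlauber.scanMatrix ord (ComplexGlauber.gibbs H lam)) (-(T : ℤ))
          (ComplexGlauber.pointMass τ) T)
        Filter.atTop (nhds (ComplexGlauber.gibbs H lam))) ∧
    -- the chain on the support is convergent
    ComplexGlauber.IsConvergentOn (Function.support (ComplexGlauber.gibbs H lam))
      (ComplexGlauber.scanMatrix ord (ComplexGlauber.gibbs H lam)) := by
  classical
  have hk0 : 0 < k := by omega
  obtain ⟨p, B, a, hp0, hB1, ha, hza, hBa, hq⟩ := exists_expansion_constants hk hΔ hε hε' hlc
  have hne : ∀ v, 1 + lam v ≠ 0 := fun v => (hq _ (hlam v)).1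
  have hp : ∀ v, ‖lam v / (1 + lam v)‖ ≤ p := fun v => (hq _ (hlam v)).2.1
  have hB : ∀ v, ‖lam v / (1 + lam v)‖ + ‖1 - lam v / (1 + lam v)‖ ≤ B :=
    fun v => (hq _ (hlam v)).2.2
  have hF := card_of_mem_edgeFinset hunif
  have hdegF := card_edgeFinset_filter_le hV hdeg
  set δ : ℕ → ℝ := fun m => B ^ (2 * n + n * (Δ * k) * k) * ((1 / 2) ^ (m / (2 * n) - 2) *
    (1 + a) ^ (n * (Δ * k))) with hδdef
  have hn : 0 < 2 * n := by have := NeZero.ne n; omega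
  have hδ : Filter.Tendsto δ Filter.atTop (nhds 0) := by
    have h1 : Filter.Tendsto (fun m : ℕ => m / (2 * n) - 2) Filter.atTop Filter.atTop :=
      (Filter.tendsto_sub_atTop_nat 2).comp (Nat.tendsto_div_const_atTop hn.ne')
    have h2 := (tendsto_pow_atTop_nhds_zero_of_lt_one (r := (1 / 2 : ℝ)) (by norm_num)
      (by norm_num)).comp h1
    simpa [hδdef] using (h2.mul_const ((1 + a) ^ (n * (Δ * k)))).const_mul
      (B ^ (2 * n + n * (Δ * k) * k))
  have hmix : ∀ E ⊆ edgeFinset H, ∀ g : (V → Fin 2) → ℂ, (∀ σ σ', ‖g σ - g σ'‖ ≤ 1) →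
      ∀ τ τ', ∀ s : ℤ, ∀ m ≥ 2 * n,
        ‖expect ord E (fun v => lam v / (1 + lam v)) s m g τ -
          expect ord E (fun v => lam v / (1 + lam v)) s m g τ'‖ ≤ δ m :=
    fun E hE g hg τ τ' s m hm =>
      norm_expect_sub_le ord hE hk0 hF hdegF hp hp0 hB hB1 ha hza hg τ τ' s hm
  have hZ : indepPoly H lam ≠ 0 := by
    have h := sum_edgeWeight_ne_zero ord hne hδ hmix ?_ (edgeFinset H) subset_rfl
    · simpa only [indepPoly, indepWeight_eq_edgeWeight] using h
    intro E hE e he m hm g hg1 hg0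
    refine (norm_expect_edge_le ord hE hk0 hF hdegF hp hp0 hB hB1 ha ?_ he 0
      (by omega) hg1 hg0).trans hBa
    -- The edge estimate does not need the factor 2 reserved for the decay.
    refine le_trans ?_ hza
    refine mul_le_mul_of_nonneg_right ?_ (by positivity)
    have : 0 ≤ p ^ k * B ^ ((Δ * k ^ 2) ^ 2 * k) := by positivity
    linarith
  have hnorm : IsNormalized (gibbs H lam) := by
    simp only [IsNormalized, gibbs, ← Finset.sum_div]
    exact div_self hZ
  have hstat := vecMul_gibbs_scanMatrix (H := H) ord hne
  have hpm : ∀ τ, IsNormalized (pointMass τ : (V → Fin 2) → ℂ) := fun τ => by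
    refine (Finset.sum_eq_single τ (fun ω _ h => ?_) (by simp)).trans ?_
    · exact if_neg h
    · exact if_pos rfl
  have hpms : ∀ τ ∈ Function.support (gibbs H lam),
      Function.support (pointMass τ : (V → Fin 2) → ℂ) ⊆ Function.support (gibbs H lam) := by
    intro τ hτ ω hω
    have : ω = τ := by
      by_contra h
      exact hω (if_neg h)
    rwa [this]
  have hconv : ∀ ν ν' : (V → Fin 2) → ℂ, IsNormalized ν → IsNormalized ν' →
      Function.support ν ⊆ Function.support (gibbs H lam) →
      Function.support ν' ⊆ Function.support (gibbs H lam) → ∀ s : ℤ, ∀ m ≥ 2 * n, ∀ ω,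
      ‖evolve (scanMatrix ord (gibbs H lam)) s ν m ω -
        evolve (scanMatrix ord (gibbs H lam)) s ν' m ω‖ ≤ (∑ τ, ‖ν τ - ν' τ‖) * δ m :=
    fun ν ν' hν hν' hνs hνs' s m hm ω => norm_evolve_scanMatrix_sub_le ord hne
      (hmix _ subset_rfl) hν hν' hνs hνs' s hm ω
  -- The decay is uniform in the starting time, so this may vary with `T`: the constant 0 gives the
  -- forward limit and `-T` the limit from the past.
  have hlim : ∀ τ ∈ Function.support (gibbs H lam), ∀ s : ℕ → ℤ, Filter.Tendsto
      (fun T : ℕ => evolve (scanMatrix ord (gibbs H lam)) (s T) (pointMass τ) T)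
      Filter.atTop (nhds (gibbs H lam)) := by
    intro τ hτ s
    rw [tendsto_pi_nhds]
    intro ω
    rw [tendsto_iff_norm_sub_tendsto_zero]
    have hd : Filter.Tendsto (fun T => (∑ σ, ‖pointMass τ σ - gibbs H lam σ‖) * δ T)
        Filter.atTop (nhds 0) := by
      simpa using hδ.const_mul (∑ σ, ‖pointMass τ σ - gibbs H lam σ‖)
    refine squeeze_zero' (Filter.Eventually.of_forall fun _ => norm_nonneg _) ?_ hd
    filter_upwards [Filter.eventually_ge_atTop (2 * n)] with T hT
    have := hconv _ _ (hpm τ) hnorm (hpms τ hτ) subset_rfl (s T) T hT ω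
    rwa [evolve_eq_of_stationary hstat] at this
  refine ⟨hZ, hnorm, fun σ hσ v => eventMeasure_gibbs_agreeOff_ne hσ (hne v), fun t σ hσ => ?_,
    hstat, fun τ hτ => hlim τ hτ fun _ => 0, fun τ hτ => hlim τ hτ fun T => -(T : ℤ), ?_⟩
  · simp only [scanMatrix_eq_siteKernel ord hσ hne]
    refine ⟨?_, fun τ h => siteKernel_mem_support hσ h⟩
    simpa using sum_siteKernel_mul (edgeFinset H) (fun v => lam v / (1 + lam v))
      (scanVertex ord t) σ fun _ => 1
  · intro ν ν' hν hν' hνs hνs'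
    have hd : Filter.Tendsto (fun T => ∑ _ω : V → Fin 2, (∑ σ, ‖ν σ - ν' σ‖) * δ T)
        Filter.atTop (nhds 0) := by
      simpa using tendsto_finsetSum (Finset.univ : Finset (V → Fin 2))
        fun _ _ => hδ.const_mul (∑ σ, ‖ν σ - ν' σ‖)
    refine squeeze_zero' (Filter.Eventually.of_forall fun _ =>
      Finset.sum_nonneg fun _ _ => norm_nonneg _) ?_ hd
    filter_upwards [Filter.eventually_ge_atTop (2 * n)] with T hT
    exact Finset.sum_le_sum fun ω _ => hconv ν ν' hν hν' hνs hνs' 0 T hT ω
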